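/- Let $G$ be a compactly generated, totally disconnected, locally compact group that is non-discrete and topologically simple (its only closed normal subgroups are $1\neq G$). A *locally normal* subgroup of $G$ is a compact subgroup whose normaliser is open. Let $\mathcal{LN}(G)$ be the set of commensurability classes $[K]$ of locally normal subgroups $K$, partially ordered by $\alpha\le\beta$ iff $\alpha=[K]$, $\beta=[L]$ for some $K\le L$; its minimum is $0=[1]$ and its maximum $\infty$ is the class of the compact open subgroups. For $\alpha\in\mathcal{LN}(G)$ write $\alpha^\perp=[C_U(K)]$, where $U$ is a compact open subgroup of $G$ and $K$ a representative of $\alpha$ that is a normal subgroup of $U$, and let $\mathcal{LC}(G)=\{\alpha^\perp \mid \alpha\in\mathcal{LN}(G)\}\subseteq\mathcal{LN}(G)$ with the induced order (this is a Boolean lattice). Let $\Omega=\Omega(G)$ be its Stone space: its points are the prime filters (equivalently, ultrafilters) of $\mathcal{LC}(G)$, and its topology is generated by the sets $\{\omega\in\Omega \mid \alpha\in\omega\}$, $\alpha\in\mathcal{LC}(G)$. Conjugation induces an action of $G$ on $\mathcal{LC}(G)$, hence on $\Omega$. A subset $V\subseteq\Omega$ is called *compressible* if it is closed and there is a net $(g_i)$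 in $G$ such that $g_i.V$ converges to a singleton in the space of closed subsets of $\Omega$ (with the Vietoris topology). **Theorem.** Assume that $\mathcal{LC}(G)\neq\{0,\infty\}$. Then: 1. $\Omega$ has no isolated point. 2. The $G$-action on $\Omega$ is continuous (that is, the map $G\times\Omega\to\Omega$ is continuous) and faithful. 3. The $G$-action on $\Omega$ is minimal: every $G$-orbit is dense. 4. The $G$-action on $\Omega$ is strongly proximal: the closure of every $G$-orbit in the space of Borel probability measures on $\Omega$, endowed with the weak-$*$ topology, contains a Dirac mass. 5. Every point of $\Omega$ has a compressible neighbourhood. -/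

import Mathlib

open Filter Topology MeasureTheory
open scoped Pointwise

/-! ### The class of groups -/

/-- `G` is generated, as an abstract group, by a compact subset. -/
def IsCompactlyGeneratedGroup (G : Type*) [Group G] [TopologicalSpace G] : Prop :=
  ∃ C : Set G, IsCompact C ∧ Subgroup.closure C = ⊤

/-- `G` is non-trivial, and its only closed normal subgroups are `1` and `G`. -/
def IsTopologicallySimpleGroup (G : Type*) [Group G] [TopologicalSpace G] : Prop :=
  Nontrivial G ∧ ∀ N : Subgroup G, N.Normal → IsClosed (N : Set G) → N = ⊥ ∨ N = ⊤

/-- The class `𝒮`: compactly generated locally compact groups that are totally disconnected,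
topologically simple, and non-discrete.  (A totally disconnected topological group is
automatically Hausdorff.) -/
class IsClassS (G : Type*) [Group G] [TopologicalSpace G] : Prop extends
    IsTopologicalGroup G, LocallyCompactSpace G, TotallyDisconnectedSpace G where
  compactlyGenerated : IsCompactlyGeneratedGroup G
  topologicallySimple : IsTopologicallySimpleGroup G
  nonDiscrete : ¬ DiscreteTopology G

/-! ### Locally normal subgroups -/

/-- A locally normal subgroup: a compact subgroup whose normaliser is open. -/
@[ext]
structure LocallyNormalSubgroup (G : Type*) [Group G] [TopologicalSpace G] where
  toSubgroup : Subgroup G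
  isCompact : IsCompact (toSubgroup : Set G)
  isOpen_normalizer : IsOpen (Subgroup.normalizer (toSubgroup : Set G) : Set G)

theorem t2Space_of_totallyDisconnected (G : Type*) [Group G] [TopologicalSpace G]
    [IsTopologicalGroup G] [TotallyDisconnectedSpace G] : T2Space G := by
  have : T1Space G := ⟨fun x => by
    have h := isClosed_connectedComponent (x := x)
    rwa [connectedComponent_eq_singleton] at h⟩
  infer_instance

/-- Van Dantzig: a totally disconnected locally compact group has a compact open subgroup. -/
theorem exists_compact_open_subgroup (G : Type*) [Group G] [TopologicalSpace G]
    [IsTopologicalGroup G] [LocallyCompactSpace G] [TotallyDisconnectedSpace G] :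
    ∃ U : Subgroup G, IsOpen (U : Set G) ∧ IsCompact (U : Set G) := by
  have := t2Space_of_totallyDisconnected G
  obtain ⟨C, hC, hC1⟩ := exists_compact_mem_nhds (1 : G)
  obtain ⟨W, hW, h1W, hWC⟩ :=
    (loc_compact_Haus_tot_disc_of_zero_dim (H := G)).mem_nhds_iff.1 hC1
  have hWclopen : IsClopen W := hW
  have hWcomp : IsCompact W := hC.of_isClosed_subset hWclopen.1 hWC
  obtain ⟨V, hV, hWV⟩ := compact_open_separated_mul_right hWcomp hWclopen.2 subset_rfl
  let H : Subgroup G :=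
    { carrier := {g | ∀ w, w ∈ W ↔ w * g ∈ W}
      one_mem' := by intro w; simp
      mul_mem' := by
        intro a b ha hb w
        rw [ha w, hb (w * a), mul_assoc]
      inv_mem' := by
        intro a ha w
        rw [ha (w * a⁻¹)]
        simp }
  have hHW : (H : Set G) ⊆ W := by
    intro g hg
    have := (hg 1).1 h1W
    simpa using this
  have hHopen : IsOpen (H : Set G) := by
    apply H.isOpen_of_mem_nhds (g := 1)
    filter_upwards [hV, inv_mem_nhds_one G hV] with g hg hg' w
    refine ⟨fun hw => hWV (Set.mul_mem_mul hw hg), fun hw => ?_⟩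
    have := hWV (Set.mul_mem_mul hw (Set.mem_inv.1 hg'))
    simpa using this
  exact ⟨H, hHopen, hWcomp.of_isClosed_subset (H.isClosed_of_isOpen hHopen) hHW⟩

theorem relIndex_ne_zero_of_isOpen_of_isCompact {G : Type*} [Group G] [TopologicalSpace G]
    [IsTopologicalGroup G] {U K : Subgroup G} (hU : IsOpen (U : Set G))
    (hK : IsCompact (K : Set G)) : U.relIndex K ≠ 0 := by
  have : CompactSpace K := isCompact_iff_compactSpace.1 hK
  have hopen : IsOpen ((U.subgroupOf K : Subgroup K) : Set K) :=
    hU.preimage continuous_subtype_val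
  have : Finite (K ⧸ U.subgroupOf K) := Subgroup.quotient_finite_of_isOpen _ hopen
  exact (Subgroup.finiteIndex_of_finite_quotient (H := U.subgroupOf K)).index_ne_zero

namespace LocallyNormalSubgroup

theorem normalizer_conj {G : Type*} [Group G] (g : G) (K : Subgroup G) :
    Subgroup.normalizer ((MulAut.conj g • K : Subgroup G) : Set G) =
      MulAut.conj g • Subgroup.normalizer (K : Set G) := by
  ext x
  rw [Subgroup.mem_pointwise_smul_iff_inv_smul_mem]
  constructor
  · intro h n
    have := h (MulAut.conj g n)
    rw [SetLike.mem_coe, SetLike.mem_coe, Subgroup.mem_pointwise_smul_iff_inv_smul_mem,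
      Subgroup.mem_pointwise_smul_iff_inv_smul_mem] at this
    simpa [MulAut.smul_def, mul_assoc] using this
  · intro h n
    have := h ((MulAut.conj g)⁻¹ n)
    rw [SetLike.mem_coe, SetLike.mem_coe, Subgroup.mem_pointwise_smul_iff_inv_smul_mem,
      Subgroup.mem_pointwise_smul_iff_inv_smul_mem]
    simpa [MulAut.smul_def, mul_assoc] using this

theorem coe_conj {G : Type*} [Group G] (g : G) (K : Subgroup G) :
    ((MulAut.conj g • K : Subgroup G) : Set G) = (fun x => g * x * g⁻¹) '' (K : Set G) := by
  rw [Subgroup.coe_pointwise_smul]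
  rfl

theorem relIndex_conj {G : Type*} [Group G] (g : G) (H K : Subgroup G) :
    (MulAut.conj g • H).relIndex (MulAut.conj g • K) = H.relIndex K :=
  Subgroup.relIndex_map_map_of_injective H K (MulAut.conj g).injective

variable {G : Type*} [Group G] [TopologicalSpace G]

/-- The trivial subgroup. -/
def trivial (G : Type*) [Group G] [TopologicalSpace G] : LocallyNormalSubgroup G where
  toSubgroup := ⊥
  isCompact := by simp
  isOpen_normalizer := by
    have h : Subgroup.normalizer ((⊥ : Subgroup G) : Set G) = ⊤ := Subgroup.normalizer_eq_top _
    rw [h]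
    exact isOpen_univ

theorem isOpen_of_le [IsTopologicalGroup G] {U N : Subgroup G} (hU : IsOpen (U : Set G))
    (h : U ≤ N) : IsOpen (N : Set G) :=
  Subgroup.isOpen_mono h hU

/-- A compact open subgroup. -/
def ofCompactOpen [IsTopologicalGroup G] (U : Subgroup G) (hU : IsOpen (U : Set G))
    (hUc : IsCompact (U : Set G)) : LocallyNormalSubgroup G where
  toSubgroup := U
  isCompact := hUc
  isOpen_normalizer := isOpen_of_le hU Subgroup.le_normalizer

/-- The centraliser `C_U(K)`, for `U` a compact open subgroup normalising `K`. -/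
def centralizerIn [IsTopologicalGroup G] [T2Space G] (U : Subgroup G) (hU : IsOpen (U : Set G))
    (hUc : IsCompact (U : Set G)) (K : LocallyNormalSubgroup G)
    (hn : U ≤ Subgroup.normalizer (K.toSubgroup : Set G)) : LocallyNormalSubgroup G where
  toSubgroup := U ⊓ Subgroup.centralizer (K.toSubgroup : Set G)
  isCompact := by
    rw [Subgroup.coe_inf]
    exact hUc.inter_right (Set.isClosed_centralizer _)
  isOpen_normalizer := by
    refine isOpen_of_le hU ?_
    have key : ∀ u ∈ U, ∀ n ∈ U ⊓ Subgroup.centralizer (K.toSubgroup : Set G),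
        u * n * u⁻¹ ∈ U ⊓ Subgroup.centralizer (K.toSubgroup : Set G) := by
      rintro u hu n ⟨hnU, hnC⟩
      refine ⟨U.mul_mem (U.mul_mem hu hnU) (U.inv_mem hu), ?_⟩
      change n ∈ Subgroup.centralizer (K.toSubgroup : Set G) at hnC
      change u * n * u⁻¹ ∈ Subgroup.centralizer (K.toSubgroup : Set G)
      rw [Subgroup.mem_centralizer_iff] at hnC ⊢
      intro k hk
      have hk' : u⁻¹ * k * u ∈ (K.toSubgroup : Set G) := by
        have := (hn (U.inv_mem hu) k).1 hk
        simpa using this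
      have h := hnC _ hk'
      calc k * (u * n * u⁻¹) = u * ((u⁻¹ * k * u) * n) * u⁻¹ := by group
        _ = u * (n * (u⁻¹ * k * u)) * u⁻¹ := by rw [h]
        _ = u * n * u⁻¹ * k := by group
    intro u hu n
    refine ⟨fun h => key u hu n h, fun h => ?_⟩
    have := key u⁻¹ (U.inv_mem hu) _ h
    simpa [mul_assoc] using this

/-- Commensurability of locally normal subgroups. -/
instance setoid (G : Type*) [Group G] [TopologicalSpace G] : Setoid (LocallyNormalSubgroup G) where
  r K L := Subgroup.Commensurable K.toSubgroup L.toSubgroup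
  iseqv := ⟨fun _ => Subgroup.Commensurable.refl _, fun h => h.symm, fun h h' => h.trans h'⟩

variable [IsTopologicalGroup G]

theorem isOpen_conj (g : G) {K : Subgroup G} (hK : IsOpen (K : Set G)) :
    IsOpen ((MulAut.conj g • K : Subgroup G) : Set G) := by
  rw [coe_conj]
  exact ((Homeomorph.mulLeft g).trans (Homeomorph.mulRight g⁻¹)).isOpenMap _ hK

theorem isCompact_conj (g : G) {K : Subgroup G} (hK : IsCompact (K : Set G)) :
    IsCompact ((MulAut.conj g • K : Subgroup G) : Set G) := by
  rw [coe_conj]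
  exact hK.image (by fun_prop)

/-- `G` acts on its locally normal subgroups by conjugation: `g • K = g K g⁻¹`. -/
instance : MulAction G (LocallyNormalSubgroup G) where
  smul g K :=
    { toSubgroup := MulAut.conj g • K.toSubgroup
      isCompact := isCompact_conj g K.isCompact
      isOpen_normalizer := by
        rw [normalizer_conj]
        exact isOpen_conj g K.isOpen_normalizer }
  one_smul K := by
    apply LocallyNormalSubgroup.ext
    change MulAut.conj (1 : G) • K.toSubgroup = K.toSubgroup
    rw [map_one, one_smul]
  mul_smul g h K := by
    apply LocallyNormalSubgroup.ext
    change MulAut.conj (g * h) • K.toSubgroup = MulAut.conj g • MulAut.conj h • K.toSubgroup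
    rw [map_mul, mul_smul]

theorem smul_toSubgroup (g : G) (K : LocallyNormalSubgroup G) :
    (g • K).toSubgroup = MulAut.conj g • K.toSubgroup := rfl

end LocallyNormalSubgroup

/-! ### The structure lattice -/

/-- The structure lattice: locally normal subgroups of `G` modulo commensurability. -/
def StructureLattice (G : Type*) [Group G] [TopologicalSpace G] : Type _ :=
  Quotient (LocallyNormalSubgroup.setoid G)

namespace StructureLattice

variable {G : Type*} [Group G] [TopologicalSpace G]

/-- The commensurability class of a locally normal subgroup. -/
def mk (K : LocallyNormalSubgroup G) : StructureLattice G := Quotient.mk _ K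

theorem mk_eq_mk {K L : LocallyNormalSubgroup G} :
    mk K = mk L ↔ Subgroup.Commensurable K.toSubgroup L.toSubgroup := Quotient.eq

/-- The order induced by inclusion of locally normal subgroups. -/
instance : LE (StructureLattice G) :=
  ⟨fun α β => ∃ K L : LocallyNormalSubgroup G,
    mk K = α ∧ mk L = β ∧ K.toSubgroup ≤ L.toSubgroup⟩

theorem le_def {α β : StructureLattice G} :
    α ≤ β ↔ ∃ K L : LocallyNormalSubgroup G,
      mk K = α ∧ mk L = β ∧ K.toSubgroup ≤ L.toSubgroup := Iff.rfl

variable [IsTopologicalGroup G] [TotallyDisconnectedSpace G]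

theorem mk_le_mk {K L : LocallyNormalSubgroup G} :
    mk K ≤ mk L ↔ L.toSubgroup.relIndex K.toSubgroup ≠ 0 := by
  have := t2Space_of_totallyDisconnected G
  constructor
  · rintro ⟨K', L', hK, hL, h⟩
    rw [mk_eq_mk] at hK hL
    have h1 : L'.toSubgroup.relIndex K'.toSubgroup ≠ 0 := by
      rw [Subgroup.relIndex_eq_one.2 h]; exact one_ne_zero
    exact Subgroup.relIndex_ne_zero_trans (Subgroup.relIndex_ne_zero_trans hL.2 h1) hK.1
  · intro h
    refine ⟨⟨K.toSubgroup ⊓ L.toSubgroup, ?_, ?_⟩, L, ?_, rfl, inf_le_right⟩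
    · rw [Subgroup.coe_inf]
      exact K.isCompact.inter_right L.isCompact.isClosed
    · refine LocallyNormalSubgroup.isOpen_of_le
        (U := Subgroup.normalizer (K.toSubgroup : Set G) ⊓
          Subgroup.normalizer (L.toSubgroup : Set G))
        (K.isOpen_normalizer.inter L.isOpen_normalizer) ?_
      rintro g ⟨hK, hL⟩ n
      exact and_congr (hK n) (hL n)
    · rw [mk_eq_mk]
      refine ⟨?_, ?_⟩
      · change (K.toSubgroup ⊓ L.toSubgroup).relIndex K.toSubgroup ≠ 0
        rwa [Subgroup.inf_relIndex_left]
      · change K.toSubgroup.relIndex (K.toSubgroup ⊓ L.toSubgroup) ≠ 0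
        rw [Subgroup.relIndex_eq_one.2 inf_le_left]
        exact one_ne_zero

instance : PartialOrder (StructureLattice G) where
  le_refl α := by
    induction α using Quotient.inductionOn with
    | h K => exact ⟨K, K, rfl, rfl, le_rfl⟩
  le_trans α β γ := by
    induction α using Quotient.inductionOn with
    | h K =>
    induction β using Quotient.inductionOn with
    | h L =>
    induction γ using Quotient.inductionOn with
    | h M =>
    intro h h'
    exact mk_le_mk.2 (Subgroup.relIndex_ne_zero_trans (mk_le_mk.1 h') (mk_le_mk.1 h))
  le_antisymm α β := by
    induction α using Quotient.inductionOn with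
    | h K =>
    induction β using Quotient.inductionOn with
    | h L =>
    intro h h'
    exact mk_eq_mk.2 ⟨mk_le_mk.1 h', mk_le_mk.1 h⟩

/-- The minimum `0`: the class of the trivial subgroup. -/
instance : OrderBot (StructureLattice G) where
  bot := mk (LocallyNormalSubgroup.trivial G)
  bot_le α := by
    induction α using Quotient.inductionOn with
    | h K => exact ⟨_, K, rfl, rfl, bot_le⟩

/-- The maximum `∞`: the class of any compact open subgroup. -/
noncomputable instance [LocallyCompactSpace G] : OrderTop (StructureLattice G) where
  top := mk (LocallyNormalSubgroup.ofCompactOpen (exists_compact_open_subgroup G).choose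
    (exists_compact_open_subgroup G).choose_spec.1 (exists_compact_open_subgroup G).choose_spec.2)
  le_top α := by
    induction α using Quotient.inductionOn with
    | h K =>
    refine mk_le_mk.2 ?_
    exact relIndex_ne_zero_of_isOpen_of_isCompact
      (exists_compact_open_subgroup G).choose_spec.1 K.isCompact

theorem top_eq [LocallyCompactSpace G] (U : Subgroup G) (hU : IsOpen (U : Set G))
    (hUc : IsCompact (U : Set G)) :
    (⊤ : StructureLattice G) = mk (LocallyNormalSubgroup.ofCompactOpen U hU hUc) := by
  refine (top_le_iff.1 ?_).symm
  refine mk_le_mk.2 ?_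
  exact relIndex_ne_zero_of_isOpen_of_isCompact hU
    (exists_compact_open_subgroup G).choose_spec.2

/-- `G` acts on the structure lattice by `g • [K] = [g K g⁻¹]`. -/
instance : MulAction G (StructureLattice G) where
  smul g := Quotient.map (fun K => g • K) (fun K L h => by
    change Subgroup.Commensurable _ _
    rw [Subgroup.Commensurable, LocallyNormalSubgroup.smul_toSubgroup,
      LocallyNormalSubgroup.smul_toSubgroup, LocallyNormalSubgroup.relIndex_conj,
      LocallyNormalSubgroup.relIndex_conj]
    exact h)
  one_smul α := by
    induction α using Quotient.inductionOn with
    | h K => exact congrArg mk (one_smul G K)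
  mul_smul g h α := by
    induction α using Quotient.inductionOn with
    | h K => exact congrArg mk (mul_smul g h K)

set_option linter.unusedSectionVars false

theorem smul_mk (g : G) (K : LocallyNormalSubgroup G) : g • mk K = mk (g • K) := rfl

instance : CovariantClass G (StructureLattice G) (· • ·) (· ≤ ·) where
  elim g α β := by
    rintro ⟨K, L, rfl, rfl, h⟩
    refine ⟨g • K, g • L, rfl, rfl, ?_⟩
    rw [LocallyNormalSubgroup.smul_toSubgroup, LocallyNormalSubgroup.smul_toSubgroup]
    exact Subgroup.map_mono h

/-- The relation `β = α^⊥`: there are a compact open subgroup `U` of `G` and a representative `K`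
of `α` that is a normal subgroup of `U`, such that `β` is the commensurability class of the
centraliser `C_U(K)`. -/
def IsPerp (α β : StructureLattice G) : Prop :=
  ∃ (U : Subgroup G) (hU : IsOpen (U : Set G)) (hUc : IsCompact (U : Set G))
    (K : LocallyNormalSubgroup G) (_ : K.toSubgroup ≤ U)
    (hn : U ≤ Subgroup.normalizer (K.toSubgroup : Set G)),
    mk K = α ∧ mk (@LocallyNormalSubgroup.centralizerIn G _ _ _
      (t2Space_of_totallyDisconnected G) U hU hUc K hn) = β

theorem smul_le_smul_of_le (g : G) {α β : StructureLattice G} (h : α ≤ β) : g • α ≤ g • β :=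
  CovariantClass.elim (μ := (· • ·)) (r := (· ≤ ·)) g h

theorem IsPerp.smul {α β : StructureLattice G} (h : IsPerp α β) (g : G) :
    IsPerp (g • α) (g • β) := by
  obtain ⟨U, hU, hUc, K, hKU, hn, rfl, rfl⟩ := h
  have hn' : MulAut.conj g • U ≤ Subgroup.normalizer ((g • K).toSubgroup : Set G) := by
    rw [LocallyNormalSubgroup.smul_toSubgroup, LocallyNormalSubgroup.normalizer_conj]
    exact Subgroup.map_mono hn
  refine ⟨MulAut.conj g • U, LocallyNormalSubgroup.isOpen_conj g hU,
    LocallyNormalSubgroup.isCompact_conj g hUc, g • K, Subgroup.map_mono hKU, hn', rfl, ?_⟩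
  rw [smul_mk]
  congr 1
  apply LocallyNormalSubgroup.ext
  ext x
  rw [LocallyNormalSubgroup.smul_toSubgroup, Subgroup.mem_pointwise_smul_iff_inv_smul_mem]
  change x ∈ (MulAut.conj g • U) ⊓ Subgroup.centralizer _ ↔
    (MulAut.conj g)⁻¹ • x ∈ U ⊓ Subgroup.centralizer _
  rw [Subgroup.mem_inf, Subgroup.mem_inf, Subgroup.mem_pointwise_smul_iff_inv_smul_mem]
  refine and_congr Iff.rfl ?_
  rw [Subgroup.mem_centralizer_iff, Subgroup.mem_centralizer_iff,
    LocallyNormalSubgroup.smul_toSubgroup, LocallyNormalSubgroup.coe_conj, Set.forall_mem_image]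
  refine forall₂_congr fun k _ => ?_
  have e : (MulAut.conj g)⁻¹ • x = g⁻¹ * x * g := by
    simp [MulAut.smul_def]
  rw [e]
  constructor
  · intro h
    have := congrArg (fun y => g⁻¹ * y * g) h
    simpa [mul_assoc] using this
  · intro h
    have := congrArg (fun y => g * y * g⁻¹) h
    simpa [mul_assoc] using this

end StructureLattice

/-! ### The centraliser lattice -/

section CentraliserLattice

variable (G : Type*) [Group G] [TopologicalSpace G] [IsTopologicalGroup G]
  [TotallyDisconnectedSpace G]

/-- The centraliser lattice `{α^⊥ | α ∈ LN(G)}`, a subset of the structure lattice, which carries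
the induced order. -/
def CentraliserLattice : Set (StructureLattice G) :=
  {β | ∃ α, StructureLattice.IsPerp α β}

/-- The action of `G` on the centraliser lattice, restricted from the structure lattice. -/
instance : MulAction G (CentraliserLattice G) where
  smul g α := ⟨g • α.1, by
    obtain ⟨β, h⟩ := α.2
    exact ⟨g • β, h.smul g⟩⟩
  one_smul α := Subtype.ext (one_smul G α.1)
  mul_smul g h α := Subtype.ext (mul_smul g h α.1)

instance : CovariantClass G (CentraliserLattice G) (· • ·) (· ≤ ·) where
  elim g α β h := StructureLattice.smul_le_smul_of_le (α := α.1) (β := β.1) g h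

end CentraliserLattice

/-! ### Stone spaces -/

/-- The points of the Stone space of (the Boolean lattice) `P`: the prime filters of `P`, which in a
Boolean lattice are the same as the ultrafilters, i.e. the maximal proper filters. -/
def StoneSpace (P : Type*) [Preorder P] : Type _ :=
  {F : Order.PFilter P // F.IsPrime}

namespace StoneSpace

variable {P : Type*} [Preorder P]

/-- The basic set of all prime filters that contain `a`. -/
def basicSet (a : P) : Set (StoneSpace P) := {F | a ∈ F.1}

/-- The Stone topology, generated by the basic sets. -/
instance : TopologicalSpace (StoneSpace P) :=
  TopologicalSpace.generateFrom (Set.range basicSet)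

/-- The Borel σ-algebra. -/
instance : MeasurableSpace (StoneSpace P) := borel _

instance : BorelSpace (StoneSpace P) := ⟨rfl⟩

variable {G : Type*} [Group G] [MulAction G P] [CovariantClass G P (· • ·) (· ≤ ·)]

theorem smul_le_smul_of_le (g : G) {a b : P} (h : a ≤ b) : g • a ≤ g • b :=
  CovariantClass.elim (μ := (· • ·)) (r := (· ≤ ·)) g h

theorem isIdeal_preimage_smul (g : G) {I : Set P} (h : Order.IsIdeal I) :
    Order.IsIdeal {a | g • a ∈ I} where
  IsLowerSet a b hba ha := h.IsLowerSet (smul_le_smul_of_le g hba) ha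
  Nonempty := by
    obtain ⟨a, ha⟩ := h.Nonempty
    exact ⟨g⁻¹ • a, by simpa using ha⟩
  Directed a ha b hb := by
    obtain ⟨c, hc, hac, hbc⟩ := h.Directed _ ha _ hb
    refine ⟨g⁻¹ • c, by simpa using hc, ?_, ?_⟩
    · simpa using smul_le_smul_of_le g⁻¹ hac
    · simpa using smul_le_smul_of_le g⁻¹ hbc

theorem isPFilter_preimage_smul (g : G) {F : Set P} (h : Order.IsPFilter F) :
    Order.IsPFilter {a | g • a ∈ F} := by
  refine Order.IsPFilter.of_def ?_ ?_ ?_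
  · obtain ⟨a, ha⟩ := h.Nonempty
    exact ⟨g⁻¹ • (OrderDual.ofDual a), by simpa using ha⟩
  · intro a ha b hb
    obtain ⟨c, hc, hac, hbc⟩ := h.Directed (OrderDual.toDual (g • a)) ha
      (OrderDual.toDual (g • b)) hb
    refine ⟨g⁻¹ • (OrderDual.ofDual c), by simpa using hc, ?_, ?_⟩
    · have := smul_le_smul_of_le g⁻¹ (OrderDual.ofDual_le_ofDual.2 hac)
      simpa using this
    · have := smul_le_smul_of_le g⁻¹ (OrderDual.ofDual_le_ofDual.2 hbc)
      simpa using this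
  · intro a b hab ha
    exact h.IsLowerSet (a := OrderDual.toDual (g • a)) (b := OrderDual.toDual (g • b))
      (smul_le_smul_of_le (P := P) g hab) ha

/-- The action on the Stone space induced by an order-preserving action on `P`:
`g • F = {g • a | a ∈ F} = {a | g⁻¹ • a ∈ F}`. -/
instance : MulAction G (StoneSpace P) where
  smul g F := ⟨(isPFilter_preimage_smul g⁻¹ F.1.isPFilter).toPFilter,
    ⟨isIdeal_preimage_smul g⁻¹ F.2.compl_ideal⟩⟩
  one_smul F := by
    apply Subtype.ext
    apply SetLike.ext
    intro a
    change (1 : G)⁻¹ • a ∈ F.1 ↔ a ∈ F.1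
    rw [inv_one, one_smul]
  mul_smul g h F := by
    apply Subtype.ext
    apply SetLike.ext
    intro a
    change (g * h)⁻¹ • a ∈ F.1 ↔ h⁻¹ • g⁻¹ • a ∈ F.1
    rw [mul_inv_rev, mul_smul]

theorem mem_smul_iff (g : G) (F : StoneSpace P) (a : P) :
    a ∈ (g • F).1 ↔ g⁻¹ • a ∈ F.1 := Iff.rfl

instance : ContinuousConstSMul G (StoneSpace P) where
  continuous_const_smul g := by
    refine continuous_generateFrom_iff.2 ?_
    rintro _ ⟨a, rfl⟩
    exact TopologicalSpace.isOpen_generateFrom_of_mem ⟨g⁻¹ • a, rfl⟩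

end StoneSpace

/-- The Stone space `Ω(G)` of the centraliser lattice of `G`. -/
abbrev StoneOmega (G : Type*) [Group G] [TopologicalSpace G] [IsTopologicalGroup G]
    [TotallyDisconnectedSpace G] : Type _ :=
  StoneSpace (CentraliserLattice G)

/-! ### Dynamics -/

section Dynamics

variable (G : Type*) {X : Type*} [Group G] [TopologicalSpace X] [MulAction G X]

/-- The closure of every `G`-orbit in the space of (Borel) probability measures on `X`, with the
weak-* topology, contains a Dirac mass.  The action on measures is by push-forward. -/
def IsStronglyProximal (X : Type*) [TopologicalSpace X] [MeasurableSpace X] [BorelSpace X]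
    [MulAction G X] [ContinuousConstSMul G X] : Prop :=
  ∀ μ : ProbabilityMeasure X, ∃ x : X,
    diracProba x ∈ closure (Set.range fun g : G =>
      μ.map (f := fun y : X => g • y) (continuous_const_smul g).measurable.aemeasurable)

/-- `V` is compressible: it is closed, and for some net of elements `g` of `G` the translates
`g • V` converge to a singleton, in the Vietoris topology on closed subsets of `X`.
The net is expressed by a proper filter on `G`; nets rather than sequences, because `X` need not
be first countable. -/
def IsCompressible (V : Set X) : Prop :=
  IsClosed V ∧ ∃ (l : Filter G) (x : X), l.NeBot ∧
    Tendsto (fun g : G => g • V) l (@nhds (Set X) (TopologicalSpace.vietoris X) {x})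

end Dynamics

/-! ### Subgroups normalised by a common subgroup -/

section Normalizer

variable {G : Type*} [Group G]

/-! Simplicity makes every nontrivial normal subgroup dense, and compact generation then shows that
a compact open `U` and finitely many elements of that subgroup generate `G`. Two consequences carry
the algebra. First, no nontrivial element centralises the germ of a nonzero `G`-invariant class:
otherwise `U` and finitely many such elements would normalise a nontrivial compact subgroup
(`germCentralizer_eq_bot`). Second, finitely many translates of any nonzero class have a
`G`-invariant join (`exists_isLUB_smul_eq`). It follows that nontrivial locally normal subgroups are
never abelian, that `α^⊥` is the pseudo-complement of `α`, and that the centraliser lattice is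
Boolean.

The dynamics uses only four facts about this Boolean algebra (`StoneSpace.dynamics`): stabilisers
are open; the action is faithful; for each nonzero `a` there are nontrivial elements, arbitrarily
close to `1`, that fix everything disjoint from `a`; finitely many translates of `a` cover.
Conjugating such an element until it leaves `U` makes it pass through a fixed compact set avoiding
`1`. Each element of that set displaces one of finitely many nonzero `d`, which must then lie below
a translate of `a`. The covering property reduces these to a single `d` having translates below
every nonzero element. A density argument with the elements supported on translates of `d` puts any
two points in a common translate of `d`.

These two properties of `d` exclude isolated points and force translates of `d` to have measure
arbitrarily close to `1`, which gives strong proximality. Compressibility needs only the first of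
them and the covering property; minimality needs covering alone. -/

theorem Subgroup.mem_normalizer_of_conj_mem {H : Subgroup G} {N : Subgroup G}
    (h : ∀ u ∈ N, ∀ n ∈ H, u * n * u⁻¹ ∈ H) : N ≤ Subgroup.normalizer (H : Set G) := by
  intro u hu n
  refine ⟨h u hu n, fun h' => ?_⟩
  have := h u⁻¹ (N.inv_mem hu) _ h'
  simpa [mul_assoc] using this

theorem Subgroup.conj_mem_of_le_normalizer {H N : Subgroup G}
    (h : N ≤ Subgroup.normalizer (H : Set G)) {u n : G} (hu : u ∈ N) (hn : n ∈ H) :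
    u * n * u⁻¹ ∈ H := (h hu n).1 hn

theorem Subgroup.le_normalizer_inf {H K N : Subgroup G}
    (hH : N ≤ Subgroup.normalizer (H : Set G)) (hK : N ≤ Subgroup.normalizer (K : Set G)) :
    N ≤ Subgroup.normalizer ((H ⊓ K : Subgroup G) : Set G) :=
  fun _ hu n => and_congr (hH hu n) (hK hu n)

theorem Subgroup.le_normalizer_sup {H K N : Subgroup G}
    (hH : N ≤ Subgroup.normalizer (H : Set G)) (hK : N ≤ Subgroup.normalizer (K : Set G)) :
    N ≤ Subgroup.normalizer ((H ⊔ K : Subgroup G) : Set G) := by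
  refine Subgroup.mem_normalizer_of_conj_mem fun u hu n hn => ?_
  have : (H ⊔ K).map (MulAut.conj u).toMonoidHom ≤ H ⊔ K := by
    rw [Subgroup.map_sup]
    refine sup_le_sup ?_ ?_
    · rintro _ ⟨x, hx, rfl⟩
      exact Subgroup.conj_mem_of_le_normalizer hH hu hx
    · rintro _ ⟨x, hx, rfl⟩
      exact Subgroup.conj_mem_of_le_normalizer hK hu hx
  exact this ⟨n, hn, rfl⟩

/-- Elements of two subgroups that normalise each other and meet trivially commute. -/
theorem Subgroup.commute_of_inf_eq_bot {H K : Subgroup G} (h : H ⊓ K = ⊥) {x y : G}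
    (hx : x ∈ H) (hy : y ∈ K) (hxK : x ∈ Subgroup.normalizer (K : Set G))
    (hyH : y ∈ Subgroup.normalizer (H : Set G)) : x * y = y * x := by
  have h1 : x * (y * x⁻¹ * y⁻¹) ∈ H := H.mul_mem hx ((hyH _).1 (H.inv_mem hx))
  have h2 : x * y * x⁻¹ * y⁻¹ ∈ K := K.mul_mem ((hxK _).1 hy) (K.inv_mem hy)
  have h3 : x * y * x⁻¹ * y⁻¹ ∈ H ⊓ K := ⟨by simpa [mul_assoc] using h1, h2⟩
  rw [h, Subgroup.mem_bot] at h3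
  rw [mul_inv_eq_one, mul_inv_eq_iff_eq_mul] at h3
  exact h3

/-- Inside `V` the indices are finite along `M ≤ HM ≤ KHM`, where normality of `H` and `M` in `V`
controls the joins, and `H ⊔ K` lies in `KHM`. -/
theorem Subgroup.relIndex_sup_ne_zero {H K M V : Subgroup G} (hHV : H ≤ V) (hKV : K ≤ V)
    (hH : V ≤ Subgroup.normalizer (H : Set G)) (hM : V ≤ Subgroup.normalizer (M : Set G))
    (h1 : M.relIndex H ≠ 0) (h2 : M.relIndex K ≠ 0) : M.relIndex (H ⊔ K) ≠ 0 := by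
  have hMn : (M.subgroupOf V).Normal :=
    ⟨fun n hn g => Subgroup.conj_mem_of_le_normalizer hM g.2 hn⟩
  have hHn : (H.subgroupOf V).Normal :=
    ⟨fun n hn g => Subgroup.conj_mem_of_le_normalizer hH g.2 hn⟩
  rw [← Subgroup.relIndex_subgroupOf hHV] at h1
  rw [← Subgroup.relIndex_subgroupOf hKV] at h2
  rw [← Subgroup.relIndex_subgroupOf (sup_le hHV hKV), Subgroup.subgroupOf_sup hHV hKV]
  generalize M.subgroupOf V = M', H.subgroupOf V = H', K.subgroupOf V = K' at *
  have h3 : M'.relIndex (H' ⊔ M') ≠ 0 := by rwa [Subgroup.relIndex_sup_right]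
  have h4 : (H' ⊔ M').relIndex (K' ⊔ (H' ⊔ M')) ≠ 0 := by
    rw [Subgroup.relIndex_sup_right]
    exact ne_zero_of_dvd_ne_zero h2 (Subgroup.relIndex_dvd_of_le_left K' le_sup_right)
  refine Subgroup.relIndex_ne_zero_trans (Subgroup.relIndex_ne_zero_trans h3 h4) ?_
  have h5 : H' ⊔ K' ≤ K' ⊔ (H' ⊔ M') := sup_le (le_sup_left.trans le_sup_right) le_sup_left
  rw [Subgroup.relIndex_eq_one.2 h5]
  exact one_ne_zero

end Normalizer

/-! ### Compact open subgroups and dense subgroups -/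

section CompactOpen

variable {G : Type*} [Group G] [TopologicalSpace G] [IsTopologicalGroup G]

/-- Inside a totally disconnected compact open subgroup `U`, the open subgroups normalised by `U`
form a neighbourhood base of `1`. -/
theorem Subgroup.exists_isOpen_subset_le_normalizer [TotallyDisconnectedSpace G] {U : Subgroup G}
    (hU : IsOpen (U : Set G)) (hUc : IsCompact (U : Set G)) {O : Set G} (hO : O ∈ 𝓝 (1 : G)) :
    ∃ V : Subgroup G, IsOpen (V : Set G) ∧ V ≤ U ∧ (V : Set G) ⊆ O ∧
      U ≤ Subgroup.normalizer (V : Set G) := by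
  have : CompactSpace U := isCompact_iff_compactSpace.1 hUc
  obtain ⟨H, hH⟩ := ProfiniteGrp.exist_openNormalSubgroup_sub_open_nhds_of_one (G := U)
    (U := Subtype.val ⁻¹' interior O) (isOpen_interior.preimage continuous_subtype_val)
    (mem_interior_iff_mem_nhds.2 hO)
  have hmap : ((H.toSubgroup.map U.subtype : Subgroup G) : Set G) =
      Subtype.val '' ((H : Set U)) := rfl
  refine ⟨H.toSubgroup.map U.subtype, ?_, ?_, ?_, ?_⟩
  · rw [hmap]
    exact hU.isOpenMap_subtype_val _ H.isOpen'
  · rintro _ ⟨x, -, rfl⟩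
    exact x.2
  · rintro _ ⟨x, hx, rfl⟩
    exact interior_subset (hH hx)
  · have key : ∀ u ∈ U, ∀ n ∈ H.toSubgroup.map U.subtype,
        u * n * u⁻¹ ∈ H.toSubgroup.map U.subtype := by
      rintro u hu _ ⟨x, hx, rfl⟩
      exact ⟨⟨u, hu⟩ * x * ⟨u, hu⟩⁻¹, H.isNormal'.conj_mem x hx ⟨u, hu⟩, rfl⟩
    intro u hu n
    refine ⟨key u hu n, fun h => ?_⟩
    have := key u⁻¹ (U.inv_mem hu) _ h
    simpa [mul_assoc] using this

/-- A dense subgroup contains a finite set that, together with a given open subgroup, generates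
a compactly generated group. -/
theorem Subgroup.exists_finite_closure_union_eq_top (hG : IsCompactlyGeneratedGroup G)
    {Q U : Subgroup G} (hQ : Dense (Q : Set G)) (hU : IsOpen (U : Set G)) :
    ∃ S : Set G, S.Finite ∧ S ⊆ Q ∧ Subgroup.closure ((U : Set G) ∪ S) = ⊤ := by
  obtain ⟨C, hC, hCtop⟩ := hG
  have hcov : C ⊆ ⋃ q : Q, (fun x => (q : G)⁻¹ * x) ⁻¹' (U : Set G) := by
    intro x _
    have hopen : IsOpen ((fun y => y⁻¹ * x) ⁻¹' (U : Set G)) :=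
      hU.preimage (by fun_prop)
    obtain ⟨q, hq, hqQ⟩ := hQ.inter_open_nonempty _ hopen ⟨x, by simp [U.one_mem]⟩
    exact Set.mem_iUnion.2 ⟨⟨q, hqQ⟩, hq⟩
  obtain ⟨t, ht⟩ := hC.elim_finite_subcover _
    (fun q : Q => hU.preimage (continuous_const_mul (q : G)⁻¹)) hcov
  refine ⟨Subtype.val '' (t : Set Q), t.finite_toSet.image _, ?_, ?_⟩
  · rintro _ ⟨q, -, rfl⟩
    exact q.2
  · rw [eq_top_iff, ← hCtop, Subgroup.closure_le]
    intro x hx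
    obtain ⟨q, hq, hqx⟩ := Set.mem_iUnion₂.1 (ht hx)
    have h1 : (q : G) ∈ Subgroup.closure ((U : Set G) ∪ Subtype.val '' (t : Set Q)) :=
      Subgroup.subset_closure (Or.inr ⟨q, hq, rfl⟩)
    have h2 : (q : G)⁻¹ * x ∈ Subgroup.closure ((U : Set G) ∪ Subtype.val '' (t : Set Q)) :=
      Subgroup.subset_closure (Or.inl hqx)
    simpa using Subgroup.mul_mem _ h1 h2

/-- Orbits of a compact group are finite if stabilisers are open. -/
theorem MulAction.finite_image_smul_of_isCompact {X : Type*} [MulAction G X] {C : Set G}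
    (hC : IsCompact C) (x : X) (hx : IsOpen (MulAction.stabilizer G x : Set G)) :
    ((fun g : G => g • x) '' C).Finite := by
  obtain ⟨t, ht⟩ := hC.elim_finite_subcover
    (fun g : G => (fun y => g⁻¹ * y) ⁻¹' (MulAction.stabilizer G x : Set G))
    (fun g => hx.preimage (continuous_const_mul g⁻¹))
    (fun y _ => Set.mem_iUnion.2 ⟨y, by simp⟩)
  refine (t.finite_toSet.image fun g => g • x).subset ?_
  rintro _ ⟨y, hy, rfl⟩
  obtain ⟨g, hg, hgy⟩ := Set.mem_iUnion₂.1 (ht hy)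
  refine ⟨g, hg, ?_⟩
  have : (g⁻¹ * y) • x = x := hgy
  rw [mul_smul, inv_smul_eq_iff] at this
  exact this.symm

end CompactOpen

/-! ### Germs of locally normal subgroups -/

namespace LocallyNormalSubgroup

variable {G : Type*} [Group G] [TopologicalSpace G] [IsTopologicalGroup G]
  [TotallyDisconnectedSpace G]

/-- The intersection of two locally normal subgroups. -/
def inf (K L : LocallyNormalSubgroup G) : LocallyNormalSubgroup G where
  toSubgroup := K.toSubgroup ⊓ L.toSubgroup
  isCompact := by
    have := t2Space_of_totallyDisconnected G
    rw [Subgroup.coe_inf]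
    exact K.isCompact.inter_right L.isCompact.isClosed
  isOpen_normalizer := isOpen_of_le
    (U := Subgroup.normalizer (K.toSubgroup : Set G) ⊓ Subgroup.normalizer (L.toSubgroup : Set G))
    (K.isOpen_normalizer.inter L.isOpen_normalizer)
    (Subgroup.le_normalizer_inf inf_le_left inf_le_right)

/-- The intersection of a locally normal subgroup with an open subgroup. -/
def restrict (K : LocallyNormalSubgroup G) (V : Subgroup G) (hV : IsOpen (V : Set G)) :
    LocallyNormalSubgroup G where
  toSubgroup := K.toSubgroup ⊓ V
  isCompact := by
    rw [Subgroup.coe_inf]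
    exact K.isCompact.inter_right (V.isClosed_of_isOpen hV)
  isOpen_normalizer := isOpen_of_le
    (U := Subgroup.normalizer (K.toSubgroup : Set G) ⊓ V)
    (K.isOpen_normalizer.inter hV)
    (Subgroup.le_normalizer_inf inf_le_left (inf_le_right.trans Subgroup.le_normalizer))

/-- The product of two locally normal subgroups that are both normal in a compact open
subgroup. -/
def sup (K L : LocallyNormalSubgroup G) {V : Subgroup G} (hV : IsOpen (V : Set G))
    (hKV : K.toSubgroup ≤ V) (hK : V ≤ Subgroup.normalizer (K.toSubgroup : Set G))
    (hL : V ≤ Subgroup.normalizer (L.toSubgroup : Set G)) : LocallyNormalSubgroup G where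
  toSubgroup := K.toSubgroup ⊔ L.toSubgroup
  isCompact := by
    rw [Subgroup.coe_mul_of_left_le_normalizer_right _ _ (hKV.trans hL)]
    exact K.isCompact.mul L.isCompact
  isOpen_normalizer := isOpen_of_le hV (Subgroup.le_normalizer_sup hK hL)

end LocallyNormalSubgroup

/-! ### The order through germs; meets, joins and stabilisers -/

namespace StructureLattice

variable {G : Type*} [Group G] [TopologicalSpace G] [IsTopologicalGroup G]
  [TotallyDisconnectedSpace G]

set_option linter.unusedSectionVars false in
theorem mk_surjective : Function.Surjective (mk : LocallyNormalSubgroup G → StructureLattice G) :=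
  Quotient.mk_surjective

theorem mk_le_mk_of_inf_le {K L : LocallyNormalSubgroup G} {V : Subgroup G}
    (hV : IsOpen (V : Set G)) (h : K.toSubgroup ⊓ V ≤ L.toSubgroup) : mk K ≤ mk L := by
  rw [mk_le_mk]
  have h1 : (K.toSubgroup ⊓ V).relIndex K.toSubgroup ≠ 0 := by
    rw [Subgroup.inf_relIndex_left]
    exact relIndex_ne_zero_of_isOpen_of_isCompact hV K.isCompact
  refine Subgroup.relIndex_ne_zero_trans ?_ h1
  rw [Subgroup.relIndex_eq_one.2 h]
  exact one_ne_zero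

set_option linter.unusedSectionVars false in
theorem mk_mono {K L : LocallyNormalSubgroup G} (h : K.toSubgroup ≤ L.toSubgroup) :
    mk K ≤ mk L := ⟨K, L, rfl, rfl, h⟩

/-- The order on the structure lattice in terms of germs. -/
theorem mk_le_mk_iff_exists [LocallyCompactSpace G] {K L : LocallyNormalSubgroup G} :
    mk K ≤ mk L ↔ ∃ V : Subgroup G, IsOpen (V : Set G) ∧ K.toSubgroup ⊓ V ≤ L.toSubgroup := by
  refine ⟨fun h => ?_, fun ⟨V, hV, h⟩ => mk_le_mk_of_inf_le hV h⟩
  rw [mk_le_mk] at h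
  have := t2Space_of_totallyDisconnected G
  have : (L.toSubgroup.subgroupOf K.toSubgroup).FiniteIndex := ⟨h⟩
  have hclosed : IsClosed ((L.toSubgroup.subgroupOf K.toSubgroup : Subgroup K.toSubgroup) :
      Set K.toSubgroup) := L.isCompact.isClosed.preimage continuous_subtype_val
  -- A closed subgroup of finite index is open, so `L ∩ K` contains a neighbourhood of `1` in `K`.
  have hopen := Subgroup.isOpen_of_isClosed_of_finiteIndex _ hclosed
  obtain ⟨O, hO, hOe⟩ := isOpen_induced_iff.1 hopen
  have h1O : (1 : G) ∈ O := by
    have : (1 : K.toSubgroup) ∈ Subtype.val ⁻¹' O := by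
      rw [hOe]; exact Subgroup.one_mem _
    exact this
  obtain ⟨U, hU, hUc⟩ := exists_compact_open_subgroup G
  obtain ⟨V, hV, -, hVO, -⟩ := Subgroup.exists_isOpen_subset_le_normalizer hU hUc
    (hO.mem_nhds h1O)
  refine ⟨V, hV, fun x hx => ?_⟩
  have : (⟨x, hx.1⟩ : K.toSubgroup) ∈ Subtype.val ⁻¹' O := hVO hx.2
  rw [hOe] at this
  exact this

theorem mk_restrict (K : LocallyNormalSubgroup G) {V : Subgroup G} (hV : IsOpen (V : Set G)) :
    mk (K.restrict V hV) = mk K :=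
  le_antisymm (mk_mono inf_le_left) (mk_le_mk_of_inf_le hV le_rfl)

theorem mk_eq_bot_iff [LocallyCompactSpace G] {K : LocallyNormalSubgroup G} :
    mk K = ⊥ ↔ ∃ V : Subgroup G, IsOpen (V : Set G) ∧ K.toSubgroup ⊓ V = ⊥ := by
  rw [← le_bot_iff]
  refine mk_le_mk_iff_exists.trans (exists_congr fun V => and_congr_right fun _ => ?_)
  exact le_bot_iff

theorem mk_inf_isGLB [LocallyCompactSpace G] (K L : LocallyNormalSubgroup G) :
    IsGLB {mk K, mk L} (mk (K.inf L)) := by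
  constructor
  · rintro _ (rfl | rfl)
    · exact mk_mono inf_le_left
    · exact mk_mono inf_le_right
  · intro γ hγ
    obtain ⟨J, rfl⟩ := mk_surjective γ
    obtain ⟨V, hV, h⟩ := mk_le_mk_iff_exists.1 (hγ (Set.mem_insert _ _))
    obtain ⟨W, hW, h'⟩ := mk_le_mk_iff_exists.1 (hγ (Set.mem_insert_of_mem _ rfl))
    exact mk_le_mk_of_inf_le (V := V ⊓ W) (hV.inter hW)
      fun x hx => ⟨h ⟨hx.1, hx.2.1⟩, h' ⟨hx.1, hx.2.2⟩⟩

theorem exists_isGLB_pair [LocallyCompactSpace G] (α β : StructureLattice G) :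
    ∃ γ, IsGLB {α, β} γ := by
  obtain ⟨K, rfl⟩ := mk_surjective α
  obtain ⟨L, rfl⟩ := mk_surjective β
  exact ⟨_, mk_inf_isGLB K L⟩

/-- Every open subgroup contains a compact open subgroup. -/
theorem exists_isCompact_isOpen_le [LocallyCompactSpace G] (N : Subgroup G)
    (hN : IsOpen (N : Set G)) :
    ∃ U : Subgroup G, IsOpen (U : Set G) ∧ IsCompact (U : Set G) ∧ U ≤ N := by
  obtain ⟨U, hU, hUc⟩ := exists_compact_open_subgroup G
  refine ⟨U ⊓ N, hU.inter hN, ?_, inf_le_right⟩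
  rw [Subgroup.coe_inf]
  exact hUc.inter_right (N.isClosed_of_isOpen hN)

/-- Once cut down to a `V` normalising both, the representatives normalise each other, and their
product represents the join: any class above both has a representative containing the product of
their intersections with a small `W` normal in `V`, which has finite index in the full product. -/
theorem exists_isLUB_pair [LocallyCompactSpace G] (α β : StructureLattice G) :
    ∃ γ, IsLUB {α, β} γ := by
  obtain ⟨K, rfl⟩ := mk_surjective α
  obtain ⟨L, rfl⟩ := mk_surjective β
  obtain ⟨V, hV, hVc, hVN⟩ := exists_isCompact_isOpen_le
    (Subgroup.normalizer (K.toSubgroup : Set G) ⊓ Subgroup.normalizer (L.toSubgroup : Set G))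
    (K.isOpen_normalizer.inter L.isOpen_normalizer)
  have hK : V ≤ Subgroup.normalizer ((K.restrict V hV).toSubgroup : Set G) :=
    Subgroup.le_normalizer_inf (hVN.trans inf_le_left) Subgroup.le_normalizer
  have hL : V ≤ Subgroup.normalizer ((L.restrict V hV).toSubgroup : Set G) :=
    Subgroup.le_normalizer_inf (hVN.trans inf_le_right) Subgroup.le_normalizer
  rw [← mk_restrict K hV, ← mk_restrict L hV]
  refine ⟨mk (LocallyNormalSubgroup.sup _ _ hV inf_le_right hK hL), ?_, ?_⟩
  · rintro _ (rfl | rfl)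
    · exact mk_mono le_sup_left
    · exact mk_mono le_sup_right
  · intro γ hγ
    obtain ⟨M, rfl⟩ := mk_surjective γ
    obtain ⟨V₁, hV₁, h₁⟩ := mk_le_mk_iff_exists.1 (hγ (Set.mem_insert _ _))
    obtain ⟨V₂, hV₂, h₂⟩ := mk_le_mk_iff_exists.1 (hγ (Set.mem_insert_of_mem _ rfl))
    obtain ⟨W, hW, -, hWV, hWn⟩ := Subgroup.exists_isOpen_subset_le_normalizer hV hVc
      ((hV₁.inter hV₂).mem_nhds ⟨V₁.one_mem, V₂.one_mem⟩)
    have hle : ((K.restrict V hV).toSubgroup ⊓ W) ⊔ ((L.restrict V hV).toSubgroup ⊓ W) ≤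
        M.toSubgroup :=
      sup_le (fun x hx => h₁ ⟨hx.1, (hWV hx.2).1⟩) (fun x hx => h₂ ⟨hx.1, (hWV hx.2).2⟩)
    have hfin : ∀ J : LocallyNormalSubgroup G, (J.toSubgroup ⊓ W).relIndex J.toSubgroup ≠ 0 := by
      intro J
      rw [Subgroup.inf_relIndex_left]
      exact relIndex_ne_zero_of_isOpen_of_isCompact hW J.isCompact
    refine mk_le_mk.2 (ne_zero_of_dvd_ne_zero ?_ (Subgroup.relIndex_dvd_of_le_left _ hle))
    refine Subgroup.relIndex_sup_ne_zero inf_le_right inf_le_right hK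
      (Subgroup.le_normalizer_sup (Subgroup.le_normalizer_inf hK hWn)
        (Subgroup.le_normalizer_inf hL hWn)) ?_ ?_
    · exact ne_zero_of_dvd_ne_zero (hfin _) (Subgroup.relIndex_dvd_of_le_left _ le_sup_left)
    · exact ne_zero_of_dvd_ne_zero (hfin _) (Subgroup.relIndex_dvd_of_le_left _ le_sup_right)

theorem exists_isLUB_finset [LocallyCompactSpace G] (T : Finset (StructureLattice G)) :
    ∃ γ, IsLUB (T : Set (StructureLattice G)) γ := by
  classical
  induction T using Finset.induction_on with
  | empty => exact ⟨⊥, by simp⟩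
  | insert a T _ ih =>
    obtain ⟨γ, hγ⟩ := ih
    obtain ⟨δ, hδ⟩ := exists_isLUB_pair a γ
    refine ⟨δ, ?_⟩
    rw [Finset.coe_insert]
    constructor
    · rintro x (rfl | hx)
      · exact hδ.1 (Set.mem_insert _ _)
      · exact (hγ.1 hx).trans (hδ.1 (Set.mem_insert_of_mem _ rfl))
    · intro x hx
      refine hδ.2 ?_
      rintro _ (rfl | rfl)
      · exact hx (Set.mem_insert _ _)
      · exact hγ.2 fun y hy => hx (Set.mem_insert_of_mem _ hy)

/-- A locally normal subgroup fixes every class above its own class. -/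
theorem smul_eq_of_mem_of_mk_le [LocallyCompactSpace G] {K : LocallyNormalSubgroup G}
    {β : StructureLattice G} (h : mk K ≤ β) {k : G} (hk : k ∈ K.toSubgroup) : k • β = β := by
  obtain ⟨W, rfl⟩ := mk_surjective β
  obtain ⟨V, hV, hKV⟩ := mk_le_mk_iff_exists.1 h
  have key : ∀ k ∈ K.toSubgroup, mk W ≤ k • mk W := by
    intro k hk
    rw [smul_mk]
    refine mk_le_mk_of_inf_le
      (V := V ⊓ MulAut.conj k • V ⊓ Subgroup.normalizer (K.toSubgroup : Set G))
      ((hV.inter (LocallyNormalSubgroup.isOpen_conj k hV)).inter K.isOpen_normalizer) ?_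
    rintro w ⟨hw, ⟨hwV, hwkV⟩, hwN⟩
    have hwkV' : k⁻¹ * w * k ∈ V := by
      have := Subgroup.mem_pointwise_smul_iff_inv_smul_mem.1 hwkV
      simpa [MulAut.smul_def] using this
    rw [LocallyNormalSubgroup.smul_toSubgroup, Subgroup.mem_pointwise_smul_iff_inv_smul_mem]
    -- The commutator lies in `K` because `w` normalises `K`, and in `V` because `w` and `k⁻¹ * w *
    -- k` do; hence it lies in `W`.
    have e : (MulAut.conj k)⁻¹ • w = (k⁻¹ * w * k * w⁻¹) * w := by
      simp [MulAut.smul_def]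
    rw [e]
    refine W.toSubgroup.mul_mem (hKV ⟨?_, V.mul_mem hwkV' (V.inv_mem hwV)⟩) hw
    have : w * k * w⁻¹ ∈ K.toSubgroup := (hwN k).1 hk
    have := K.toSubgroup.mul_mem (K.toSubgroup.inv_mem hk) this
    simpa [mul_assoc] using this
  refine le_antisymm ?_ (key k hk)
  have := smul_le_smul_of_le k (key k⁻¹ (K.toSubgroup.inv_mem hk))
  simpa using this

theorem isOpen_stabilizer (α : StructureLattice G) :
    IsOpen (MulAction.stabilizer G α : Set G) := by
  obtain ⟨K, rfl⟩ := mk_surjective α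
  refine Subgroup.isOpen_mono (H₁ := Subgroup.normalizer (K.toSubgroup : Set G)) ?_
    K.isOpen_normalizer
  intro g hg
  rw [MulAction.mem_stabilizer_iff, smul_mk]
  congr 1
  apply LocallyNormalSubgroup.ext
  rw [LocallyNormalSubgroup.smul_toSubgroup]
  ext x
  rw [Subgroup.mem_pointwise_smul_iff_inv_smul_mem]
  have := hg (g⁻¹ * x * g)
  simpa [MulAut.smul_def, mul_assoc] using this

end StructureLattice

/-! ### Invariant germs in groups of class `𝒮` -/

/-- The elements that centralise an open subgroup of `K`. -/
def Subgroup.germCentralizer {G : Type*} [Group G] [TopologicalSpace G] (K : Subgroup G) :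
    Subgroup G where
  carrier := {g | ∃ V : Subgroup G, IsOpen (V : Set G) ∧ ∀ k ∈ K ⊓ V, k * g = g * k}
  one_mem' := ⟨⊤, isOpen_univ, fun k _ => by simp⟩
  mul_mem' := by
    rintro a b ⟨V, hV, ha⟩ ⟨W, hW, hb⟩
    refine ⟨V ⊓ W, hV.inter hW, fun k hk => ?_⟩
    rw [← mul_assoc, ha k ⟨hk.1, hk.2.1⟩, mul_assoc, hb k ⟨hk.1, hk.2.2⟩, mul_assoc]
  inv_mem' := by
    rintro a ⟨V, hV, ha⟩
    exact ⟨V, hV, fun k hk => ((Commute.inv_right (show Commute k a from ha k hk))).eq⟩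

/-! ### Compact normal subgroups are trivial, nontrivial normal subgroups are dense -/

namespace IsClassS

variable {G : Type*} [Group G] [TopologicalSpace G] [IsClassS G]

/-- Otherwise `G` itself is profinite; a proper open normal subgroup is closed, hence trivial by
simplicity, and `G` would be discrete. -/
theorem eq_bot_of_normal_of_isCompact {N : Subgroup G} (hN : N.Normal)
    (hc : IsCompact (N : Set G)) : N = ⊥ := by
  have := t2Space_of_totallyDisconnected G
  have hS := IsClassS.topologicallySimple (G := G)
  have := hS.1
  refine (hS.2 N hN hc.isClosed).resolve_right ?_
  rintro rfl
  have : CompactSpace G := ⟨by simpa using hc⟩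
  obtain ⟨x, hx⟩ := exists_ne (1 : G)
  obtain ⟨H, hH⟩ := ProfiniteGrp.exist_openNormalSubgroup_sub_open_nhds_of_one
    (isOpen_compl_singleton (x := x)) hx.symm
  rcases hS.2 H.toSubgroup H.isNormal' (Subgroup.isClosed_of_isOpen _ H.isOpen') with h | h
  · refine IsClassS.nonDiscrete (G := G) (discreteTopology_of_isOpen_singleton_one ?_)
    have := H.isOpen'
    have h' : (H.toSubgroup : Set G) = {1} := by rw [h]; rfl
    rw [← h']
    exact this
  · have : x ∈ H.toSubgroup := by rw [h]; trivial
    exact hH this rfl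

theorem dense_of_normal {N : Subgroup G} (hN : N.Normal) (h : N ≠ ⊥) : Dense (N : Set G) := by
  rcases (IsClassS.topologicallySimple (G := G)).2 N.topologicalClosure
    (Subgroup.is_normal_topologicalClosure N) N.isClosed_topologicalClosure with h' | h'
  · exact absurd (le_bot_iff.1 (h' ▸ N.le_topologicalClosure)) h
  · rw [dense_iff_closure_eq, ← Subgroup.topologicalClosure_coe, h']
    rfl

theorem exists_finite_closure_union_eq_top {N U : Subgroup G} (hN : N.Normal) (h : N ≠ ⊥)
    (hU : IsOpen (U : Set G)) :
    ∃ S : Set G, S.Finite ∧ S ⊆ N ∧ Subgroup.closure ((U : Set G) ∪ S) = ⊤ :=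
  Subgroup.exists_finite_closure_union_eq_top IsClassS.compactlyGenerated
    (dense_of_normal hN h) hU

end IsClassS

/-! ### Invariant classes and invariant joins of translates -/

namespace StructureLattice

variable {G : Type*} [Group G] [TopologicalSpace G] [IsClassS G]

/-- If a nontrivial class is fixed by `G`, then no nontrivial element centralises an open subgroup
of a representative. -/
theorem germCentralizer_eq_bot {K : LocallyNormalSubgroup G} (hfix : ∀ g : G, g • mk K = mk K)
    (hK : mk K ≠ ⊥) : K.toSubgroup.germCentralizer = ⊥ := by
  by_contra hQ
  -- Invariance of the class means that `K` and `hKh⁻¹` agree near `1`, so conjugation by `h`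
  -- preserves the condition of centralising the germ of `K`.
  have hn : K.toSubgroup.germCentralizer.Normal := by
    constructor
    rintro g ⟨V, hV, hg⟩ h
    obtain ⟨W, hW, hKW⟩ := mk_le_mk_iff_exists.1 (((smul_mk h K).symm.trans (hfix h)).ge)
    refine ⟨W ⊓ MulAut.conj h • V, hW.inter (LocallyNormalSubgroup.isOpen_conj h hV), ?_⟩
    rintro k ⟨hk, hkW, hkV⟩
    have h1 := hKW ⟨hk, hkW⟩
    rw [LocallyNormalSubgroup.smul_toSubgroup] at h1
    have h2 := hg _ ⟨Subgroup.mem_pointwise_smul_iff_inv_smul_mem.1 h1,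
      Subgroup.mem_pointwise_smul_iff_inv_smul_mem.1 hkV⟩
    have h3 := congrArg (fun x => h * x * h⁻¹) h2
    simpa [MulAut.smul_def, mul_assoc] using h3
  obtain ⟨U, hU, hUc, hUN⟩ := exists_isCompact_isOpen_le _ K.isOpen_normalizer
  obtain ⟨S, hSf, hSQ, hS⟩ := IsClassS.exists_finite_closure_union_eq_top hn hQ hU
  choose! V hV hVS using fun s (hs : s ∈ S) => (hSQ hs : s ∈ K.toSubgroup.germCentralizer)
  have hO : (⋂ s ∈ S, (V s : Set G)) ∈ 𝓝 (1 : G) :=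
    (Filter.biInter_mem hSf).2 fun s hs => (hV s hs).mem_nhds (V s).one_mem
  obtain ⟨W, hW, -, hWO, hWn⟩ := Subgroup.exists_isOpen_subset_le_normalizer hU hUc hO
  have hcomm : ∀ s ∈ S, ∀ k ∈ K.toSubgroup ⊓ W, k * s = s * k := fun s hs k hk =>
    hVS s hs k ⟨hk.1, Set.mem_iInter₂.1 (hWO hk.2) s hs⟩
  -- `U` normalises `K ⊓ W` and the finite set `S` centralises it; together they generate `G`.
  have htop : Subgroup.normalizer ((K.toSubgroup ⊓ W : Subgroup G) : Set G) = ⊤ := by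
    rw [eq_top_iff, ← hS, Subgroup.closure_le, Set.union_subset_iff]
    refine ⟨Subgroup.le_normalizer_inf hUN hWn, fun s hs n => ⟨fun h => ?_, fun h => ?_⟩⟩
    · have : s * n * s⁻¹ = n := by rw [← hcomm s hs n h, mul_inv_cancel_right]
      rwa [this]
    · have h1 := hcomm s hs _ h
      have : n = s * n * s⁻¹ := by
        rw [inv_mul_cancel_right] at h1
        exact mul_left_cancel h1
      rwa [this]
  have hbot := IsClassS.eq_bot_of_normal_of_isCompact (Subgroup.normalizer_eq_top_iff.1 htop)
    (K.restrict W hW).isCompact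
  exact hK (mk_eq_bot_iff.2 ⟨W, hW, hbot⟩)

theorem bot_ne_top : (⊥ : StructureLattice G) ≠ ⊤ := by
  have := t2Space_of_totallyDisconnected G
  obtain ⟨U, hU, hUc⟩ := exists_compact_open_subgroup G
  rw [top_eq U hU hUc]
  intro h
  obtain ⟨V, hV, hUV⟩ := mk_eq_bot_iff.1 h.symm
  refine IsClassS.nonDiscrete (G := G) (discreteTopology_of_isOpen_singleton_one ?_)
  have h' : ((U ⊓ V : Subgroup G) : Set G) = {1} := by
    change U ⊓ V = ⊥ at hUV
    rw [hUV]; rfl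
  rw [← h']
  exact hU.inter hV

theorem smul_top (g : G) : g • (⊤ : StructureLattice G) = ⊤ := by
  refine top_le_iff.1 ?_
  have := smul_le_smul_of_le g (le_top (a := g⁻¹ • (⊤ : StructureLattice G)))
  simpa using this

/-- The quasi-centre of a group of class `𝒮` is trivial. -/
theorem eq_one_of_commute_isOpen {g : G} {V : Subgroup G} (hV : IsOpen (V : Set G))
    (h : ∀ k ∈ V, k * g = g * k) : g = 1 := by
  obtain ⟨U, hU, hUc⟩ := exists_compact_open_subgroup G
  have hbot := germCentralizer_eq_bot (K := LocallyNormalSubgroup.ofCompactOpen U hU hUc)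
    (fun g => by rw [← top_eq U hU hUc, smul_top])
    (by rw [← top_eq U hU hUc]; exact bot_ne_top.symm)
  have : g ∈ (LocallyNormalSubgroup.ofCompactOpen U hU hUc).toSubgroup.germCentralizer :=
    ⟨V, hV, fun k hk => h k hk.2⟩
  rw [hbot] at this
  exact this

/-- For `k ∈ K` and `v` near `1`, the commutator of `k` and `v` lies in `K ⊓ V = ⊥`. So `k` commutes
with an open subgroup, and the quasi-centre is trivial. -/
theorem toSubgroup_eq_bot {K : LocallyNormalSubgroup G} (hK : mk K = ⊥) :
    K.toSubgroup = ⊥ := by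
  obtain ⟨V, hV, hKV⟩ := mk_eq_bot_iff.1 hK
  refine (Subgroup.eq_bot_iff_forall _).2 fun k hk => ?_
  refine eq_one_of_commute_isOpen
    (V := V ⊓ MulAut.conj k • V ⊓ Subgroup.normalizer (K.toSubgroup : Set G))
    ((hV.inter (LocallyNormalSubgroup.isOpen_conj k hV)).inter K.isOpen_normalizer) ?_
  rintro v ⟨⟨hvV, hvk⟩, hvN⟩
  have hvk' : k⁻¹ * v * k ∈ V := by
    have := Subgroup.mem_pointwise_smul_iff_inv_smul_mem.1 hvk
    simpa [MulAut.smul_def] using this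
  have h1 : k⁻¹ * v * k * v⁻¹ ∈ K.toSubgroup ⊓ V := by
    refine ⟨?_, V.mul_mem hvk' (V.inv_mem hvV)⟩
    have : v * k * v⁻¹ ∈ K.toSubgroup := (hvN k).1 hk
    have := K.toSubgroup.mul_mem (K.toSubgroup.inv_mem hk) this
    simpa [mul_assoc] using this
  rw [hKV, Subgroup.mem_bot, mul_inv_eq_one, mul_assoc, inv_mul_eq_iff_eq_mul] at h1
  exact h1

/-- Finitely many translates of a nontrivial class have a `G`-invariant least upper bound. -/
theorem exists_isLUB_smul_eq {α : StructureLattice G} (hα : α ≠ ⊥) :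
    ∃ (T : Finset (StructureLattice G)) (β : StructureLattice G), α ∈ T ∧
      (∀ τ ∈ T, ∃ g : G, τ = g • α) ∧ IsLUB (T : Set (StructureLattice G)) β ∧
      ∀ g : G, g • β = β := by
  classical
  obtain ⟨K, rfl⟩ := mk_surjective α
  have hN : Subgroup.normalClosure (K.toSubgroup : Set G) ≠ ⊥ := by
    intro h
    refine hα (mk_eq_bot_iff.2 ⟨⊤, isOpen_univ, ?_⟩)
    rw [inf_top_eq, eq_bot_iff, ← h]
    exact Subgroup.subset_normalClosure
  obtain ⟨U, hU, hUc⟩ := exists_compact_open_subgroup G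
  obtain ⟨S, hSf, hSN, hS⟩ :=
    IsClassS.exists_finite_closure_union_eq_top Subgroup.normalClosure_normal hN hU
  -- An element of the normal closure is a product of elements of conjugates of `K`, and each
  -- conjugate fixes all classes above its own. So finitely many translates suffice for each `s`.
  have key : ∀ s ∈ Subgroup.normalClosure (K.toSubgroup : Set G),
      ∃ T : Finset (StructureLattice G), (∀ τ ∈ T, ∃ g : G, τ = g • mk K) ∧
        ∀ β, (∀ τ ∈ T, τ ≤ β) → s • β = β := by
    intro s hs
    refine Subgroup.closure_induction ?_ ?_ ?_ ?_ hs
    · intro x hx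
      obtain ⟨k, hk, hkx⟩ := Group.mem_conjugatesOfSet_iff.1 hx
      obtain ⟨g, rfl⟩ := isConj_iff.1 hkx
      refine ⟨{g • mk K}, fun τ hτ => ⟨g, Finset.mem_singleton.1 hτ⟩, fun β hβ => ?_⟩
      refine smul_eq_of_mem_of_mk_le (K := g • K) (hβ _ (Finset.mem_singleton_self _)) ?_
      rw [LocallyNormalSubgroup.smul_toSubgroup, Subgroup.mem_pointwise_smul_iff_inv_smul_mem]
      simpa [MulAut.smul_def, mul_assoc] using hk
    · exact ⟨∅, by simp, fun β _ => one_smul G β⟩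
    · rintro x y _ _ ⟨T, hT, hTx⟩ ⟨T', hT', hTy⟩
      refine ⟨T ∪ T', fun τ hτ => (Finset.mem_union.1 hτ).elim (hT τ) (hT' τ), fun β hβ => ?_⟩
      rw [mul_smul, hTy β fun τ hτ => hβ τ (Finset.mem_union_right _ hτ),
        hTx β fun τ hτ => hβ τ (Finset.mem_union_left _ hτ)]
    · rintro x _ ⟨T, hT, hTx⟩
      exact ⟨T, hT, fun β hβ => inv_smul_eq_iff.2 (hTx β hβ).symm⟩
  choose! T hT hTS using key
  let T₀ : Set (StructureLattice G) := insert (mk K) (⋃ s ∈ S, (T s : Set _))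
  have hT₀f : T₀.Finite := (hSf.biUnion fun s _ => (T s).finite_toSet).insert _
  have hT₀ : ∀ τ ∈ T₀, ∃ g : G, τ = g • mk K := by
    rintro τ (rfl | hτ)
    · exact ⟨1, (one_smul G _).symm⟩
    · obtain ⟨s, hs, hτs⟩ := Set.mem_iUnion₂.1 hτ
      exact hT s (hSN hs) τ hτs
  -- Closing up under the compact group `U` keeps the family finite and makes its join
  -- `U`-invariant; the elements of `S` fix the join because it bounds the translates attached to
  -- them.
  have hfin : (⋃ τ ∈ T₀, (fun u : G => u • τ) '' (U : Set G)).Finite :=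
    hT₀f.biUnion fun τ _ => MulAction.finite_image_smul_of_isCompact hUc τ (isOpen_stabilizer τ)
  have hsub : ∀ τ ∈ T₀, τ ∈ hfin.toFinset := fun τ hτ =>
    hfin.mem_toFinset.2 (Set.mem_iUnion₂.2 ⟨τ, hτ, 1, U.one_mem, one_smul G τ⟩)
  obtain ⟨β, hβ⟩ := exists_isLUB_finset hfin.toFinset
  refine ⟨hfin.toFinset, β, hsub _ (Set.mem_insert _ _), ?_, hβ, ?_⟩
  · intro τ hτ
    obtain ⟨σ, hσ, u, -, rfl⟩ := Set.mem_iUnion₂.1 (hfin.mem_toFinset.1 hτ)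
    obtain ⟨g, rfl⟩ := hT₀ σ hσ
    exact ⟨u * g, (mul_smul u g _).symm⟩
  · have hle : ∀ u ∈ U, β ≤ u • β := by
      intro u hu
      refine hβ.2 fun τ hτ => ?_
      obtain ⟨σ, hσ, v, hv, rfl⟩ := Set.mem_iUnion₂.1 (hfin.mem_toFinset.1 hτ)
      have h1 : (u⁻¹ * v) • σ ≤ β := hβ.1 (hfin.mem_toFinset.2
        (Set.mem_iUnion₂.2 ⟨σ, hσ, u⁻¹ * v, U.mul_mem (U.inv_mem hu) hv, rfl⟩))
      simpa [mul_smul] using smul_le_smul_of_le u h1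
    have hstab : MulAction.stabilizer G β = ⊤ := by
      rw [eq_top_iff, ← hS, Subgroup.closure_le, Set.union_subset_iff]
      refine ⟨fun u hu => ?_, fun s hs => ?_⟩
      · refine le_antisymm ?_ (hle u hu)
        simpa using smul_le_smul_of_le u (hle u⁻¹ (U.inv_mem hu))
      · exact hTS s (hSN hs) β fun τ hτ =>
          hβ.1 (hsub τ (Or.inr (Set.mem_iUnion₂.2 ⟨s, hs, hτ⟩)))
    intro g
    have : g ∈ MulAction.stabilizer G β := by rw [hstab]; trivial
    exact this

end StructureLattice

/-! ### Pseudo-complements in the structure lattice -/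

namespace StructureLattice

variable {G : Type*} [Group G] [TopologicalSpace G] [IsClassS G]

theorem inf_eq_bot_of_disjoint {K L : LocallyNormalSubgroup G} (h : Disjoint (mk K) (mk L)) :
    K.toSubgroup ⊓ L.toSubgroup = ⊥ :=
  toSubgroup_eq_bot (K := K.inf L)
    (le_bot_iff.1 (h (mk_mono inf_le_left) (mk_mono inf_le_right)))

/-- Treat the classes one at a time. If `D ⊓ L` is trivial, `D` and `L` commute after restriction to
each other's normalisers. Otherwise replace `D` by `D ⊓ L`, which commutes with the abelian group
`L`. -/
theorem exists_commute_of_disjoint {K : LocallyNormalSubgroup G}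
    {T : Finset (StructureLattice G)} (hK : mk K ≠ ⊥)
    (hT : ∀ τ ∈ T, ∃ L, mk L = τ ∧ ∀ a ∈ L.toSubgroup, ∀ b ∈ L.toSubgroup, a * b = b * a) :
    ∃ D : LocallyNormalSubgroup G, mk D ≠ ⊥ ∧ ∀ τ ∈ T, ∃ L : LocallyNormalSubgroup G,
      mk L = τ ∧ ∀ d ∈ D.toSubgroup, ∀ l ∈ L.toSubgroup, d * l = l * d := by
  classical
  induction T using Finset.induction_on with
  | empty => exact ⟨K, hK, by simp⟩
  | insert τ T _ ih =>
    obtain ⟨D, hD, hDT⟩ := ih fun τ hτ => hT τ (Finset.mem_insert_of_mem hτ)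
    obtain ⟨L, rfl, hL⟩ := hT τ (Finset.mem_insert_self _ _)
    by_cases hDL : mk (D.inf L) = ⊥
    · have hbot := toSubgroup_eq_bot hDL
      refine ⟨D.restrict _ L.isOpen_normalizer, by rwa [mk_restrict], fun σ hσ => ?_⟩
      rcases Finset.mem_insert.1 hσ with rfl | hσ
      · exact ⟨L.restrict _ D.isOpen_normalizer, mk_restrict _ _, fun d hd l hl =>
          Subgroup.commute_of_inf_eq_bot hbot hd.1 hl.1 hd.2 hl.2⟩
      · obtain ⟨M, hM, hMD⟩ := hDT σ hσ
        exact ⟨M, hM, fun d hd => hMD d hd.1⟩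
    · refine ⟨D.inf L, hDL, fun σ hσ => ?_⟩
      rcases Finset.mem_insert.1 hσ with rfl | hσ
      · exact ⟨L, rfl, fun d hd l hl => hL d hd.2 l hl⟩
      · obtain ⟨M, hM, hMD⟩ := hDT σ hσ
        exact ⟨M, hM, fun d hd => hMD d hd.1⟩

/-- Groups of class `𝒮` have no nontrivial abelian locally normal subgroup. -/
theorem eq_bot_of_commutative {A : LocallyNormalSubgroup G}
    (hA : ∀ a ∈ A.toSubgroup, ∀ b ∈ A.toSubgroup, a * b = b * a) : A.toSubgroup = ⊥ := by
  by_contra hne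
  have hA0 : mk A ≠ ⊥ := fun h => hne (toSubgroup_eq_bot h)
  obtain ⟨T, β, hAT, hT, hβ, hfix⟩ := exists_isLUB_smul_eq hA0
  obtain ⟨D, hD, hDT⟩ := exists_commute_of_disjoint (T := T) hA0 (by
    intro τ hτ
    obtain ⟨g, rfl⟩ := hT τ hτ
    refine ⟨g • A, rfl, ?_⟩
    rw [LocallyNormalSubgroup.smul_toSubgroup]
    rintro _ ⟨a, ha, rfl⟩ _ ⟨b, hb, rfl⟩
    change MulAut.conj g a * MulAut.conj g b = MulAut.conj g b * MulAut.conj g a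
    rw [← map_mul, hA a ha b hb, map_mul])
  have := t2Space_of_totallyDisconnected G
  obtain ⟨V, hV, hVc, hVN⟩ := exists_isCompact_isOpen_le _ D.isOpen_normalizer
  have hn : V ≤ Subgroup.normalizer ((D.restrict V hV).toSubgroup : Set G) :=
    Subgroup.le_normalizer_inf hVN Subgroup.le_normalizer
  -- `D` commutes with representatives of all translates in `T`, so their invariant join lies below
  -- the centraliser. Then `D ⊓ V` centralises the germ of `β`, contradicting the triviality of its
  -- germ centraliser.
  have hβC : β ≤ mk (LocallyNormalSubgroup.centralizerIn V hV hVc (D.restrict V hV) hn) := by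
    refine hβ.2 fun τ hτ => ?_
    obtain ⟨L, rfl, hL⟩ := hDT τ hτ
    exact mk_le_mk_of_inf_le hV fun l hl =>
      ⟨hl.2, Subgroup.mem_centralizer_iff.2 fun d hd => hL d hd.1 l hl.1⟩
  obtain ⟨M, rfl⟩ := mk_surjective β
  have hQ := germCentralizer_eq_bot hfix (ne_bot_of_le_ne_bot hA0 (hβ.1 hAT))
  obtain ⟨W, hW, hMW⟩ := mk_le_mk_iff_exists.1 hβC
  refine hD (mk_eq_bot_iff.2 ⟨V, hV, (Subgroup.eq_bot_iff_forall _).2 fun d hd => ?_⟩)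
  have : d ∈ M.toSubgroup.germCentralizer :=
    ⟨W, hW, fun k hk => (Subgroup.mem_centralizer_iff.1 (hMW hk).2 d hd).symm⟩
  rw [hQ] at this
  exact this

/-- This makes `β` the pseudo-complement of `α`. Anything below both `C_U(K)` and `K` is locally
abelian, hence zero. Conversely, a class disjoint from `[K]` has a representative meeting `K`
trivially, and normalising subgroups that meet trivially commute. -/
theorem IsPerp.le_iff_disjoint {α β γ : StructureLattice G} (h : IsPerp α β) :
    γ ≤ β ↔ Disjoint γ α := by
  have := t2Space_of_totallyDisconnected G
  obtain ⟨U, hU, hUc, K, hKU, hn, rfl, rfl⟩ := h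
  constructor
  · intro hγ ε hεγ hεK
    obtain ⟨E, rfl⟩ := mk_surjective ε
    obtain ⟨V, hV, hEV⟩ := mk_le_mk_iff_exists.1 (hεγ.trans hγ)
    obtain ⟨W, hW, hEW⟩ := mk_le_mk_iff_exists.1 hεK
    have hVW : IsOpen ((V ⊓ W : Subgroup G) : Set G) := hV.inter hW
    have := eq_bot_of_commutative (A := E.restrict _ hVW) (by
      rintro a ⟨haE, haV, -⟩ b ⟨hbE, -, hbW⟩
      exact (Subgroup.mem_centralizer_iff.1 (hEV ⟨haE, haV⟩).2 b (hEW ⟨hbE, hbW⟩)).symm)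
    exact (mk_eq_bot_iff.2 ⟨_, hVW, this⟩).le
  · intro hdis
    obtain ⟨J, rfl⟩ := mk_surjective γ
    have hJK := inf_eq_bot_of_disjoint hdis
    obtain ⟨W, hW, hWU, hWO, hWn⟩ := Subgroup.exists_isOpen_subset_le_normalizer hU hUc
      (J.isOpen_normalizer.mem_nhds (Subgroup.one_mem _))
    have hn' : U ≤ Subgroup.normalizer ((K.restrict W hW).toSubgroup : Set G) :=
      Subgroup.le_normalizer_inf hn hWn
    -- Only `K ⊓ W` is known to normalise `J`, so a first commutation argument places `J ⊓ U` in `H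
    -- = C_U(K ⊓ W)`. Since `H` and `K` are normalised by `U` and meet trivially, a second one shows
    -- that `H` centralises all of `K`.
    let H := LocallyNormalSubgroup.centralizerIn U hU hUc (K.restrict W hW) hn'
    have hHn : U ≤ Subgroup.normalizer (H.toSubgroup : Set G) := by
      refine Subgroup.mem_normalizer_of_conj_mem fun u hu x hx => ?_
      refine ⟨U.mul_mem (U.mul_mem hu hx.1) (U.inv_mem hu),
        Subgroup.mem_centralizer_iff.2 fun k hk => ?_⟩
      have h1 := Subgroup.conj_mem_of_le_normalizer hn' (U.inv_mem hu) hk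
      have h2 := congrArg (fun y => u * y * u⁻¹) (Subgroup.mem_centralizer_iff.1 hx.2 _ h1)
      simpa [mul_assoc] using h2
    have hHK : H.toSubgroup ⊓ K.toSubgroup = ⊥ := by
      refine toSubgroup_eq_bot (K := H.inf K) (mk_eq_bot_iff.2 ⟨W, hW, ?_⟩)
      refine eq_bot_of_commutative (A := (H.inf K).restrict W hW) ?_
      rintro a ⟨⟨haH, -⟩, -⟩ b ⟨⟨-, hbK⟩, hbW⟩
      exact (Subgroup.mem_centralizer_iff.1 haH.2 b ⟨hbK, hbW⟩).symm
    refine mk_le_mk_of_inf_le hU ?_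
    rintro j ⟨hj, hjU⟩
    have hjH : j ∈ H.toSubgroup := by
      refine ⟨hjU, Subgroup.mem_centralizer_iff.2 fun k hk => ?_⟩
      exact (Subgroup.commute_of_inf_eq_bot hJK hj hk.1 (hn hjU) (hWO hk.2)).symm
    refine ⟨hjU, Subgroup.mem_centralizer_iff.2 fun k hk => ?_⟩
    exact (Subgroup.commute_of_inf_eq_bot hHK hjH hk (hn hjU) (hHn (hKU hk))).symm

theorem exists_isPerp (α : StructureLattice G) : ∃ β, IsPerp α β := by
  obtain ⟨K, rfl⟩ := mk_surjective α
  obtain ⟨V, hV, hVc, hVN⟩ := exists_isCompact_isOpen_le _ K.isOpen_normalizer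
  exact ⟨_, V, hV, hVc, K.restrict V hV, inf_le_right,
    Subgroup.le_normalizer_inf hVN Subgroup.le_normalizer, mk_restrict K hV, rfl⟩

theorem bot_mem_centraliserLattice : (⊥ : StructureLattice G) ∈ CentraliserLattice G := by
  obtain ⟨β, hβ⟩ := exists_isPerp (⊤ : StructureLattice G)
  have : β = ⊥ := le_bot_iff.1 (hβ.le_iff_disjoint.1 le_rfl le_rfl le_top)
  exact ⟨⊤, this ▸ hβ⟩

theorem top_mem_centraliserLattice : (⊤ : StructureLattice G) ∈ CentraliserLattice G := by
  obtain ⟨β, hβ⟩ := exists_isPerp (⊥ : StructureLattice G)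
  have : β = ⊤ := top_le_iff.1 (hβ.le_iff_disjoint.2 disjoint_bot_right)
  exact ⟨⊥, this ▸ hβ⟩

/-- A nontrivial class fixed by `G` is disjoint only from the trivial class. -/
theorem eq_bot_of_disjoint_of_smul_eq {β γ : StructureLattice G} (hβ : β ≠ ⊥)
    (hfix : ∀ g : G, g • β = β) (h : Disjoint γ β) : γ = ⊥ := by
  obtain ⟨M, rfl⟩ := mk_surjective β
  obtain ⟨J, rfl⟩ := mk_surjective γ
  have hJM := inf_eq_bot_of_disjoint h
  refine mk_eq_bot_iff.2 ⟨_, M.isOpen_normalizer, (Subgroup.eq_bot_iff_forall _).2 fun j hj => ?_⟩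
  have : j ∈ M.toSubgroup.germCentralizer := ⟨_, J.isOpen_normalizer, fun k hk =>
    (Subgroup.commute_of_inf_eq_bot hJM hj.1 hk.1 hj.2 hk.2).symm⟩
  rw [germCentralizer_eq_bot hfix hβ] at this
  exact this

/-- Only the trivial class is disjoint from sufficiently many translates of a nontrivial class. -/
theorem exists_finset_forall_disjoint {α : StructureLattice G} (hα : α ≠ ⊥) :
    ∃ F : Finset G, ∀ β, (∀ g ∈ F, Disjoint β (g • α)) → β = ⊥ := by
  classical
  obtain ⟨T, γ, hαT, hT, hγ, hfix⟩ := exists_isLUB_smul_eq hα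
  choose! f hf using hT
  refine ⟨T.image f, fun β hβ => ?_⟩
  obtain ⟨δ, hδ⟩ := exists_isPerp β
  -- Passing through `δ = β^⊥` turns disjointness from every translate into disjointness from their
  -- join, without distributivity.
  refine eq_bot_of_disjoint_of_smul_eq (ne_bot_of_le_ne_bot hα (hγ.1 hαT)) hfix
    (hδ.le_iff_disjoint.1 (hγ.2 fun τ hτ => ?_)).symm
  rw [hδ.le_iff_disjoint, hf τ hτ]
  exact (hβ _ (Finset.mem_image_of_mem f hτ)).symm

/-- Every nontrivial class is represented by arbitrarily small nontrivial elements that act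
trivially on all classes disjoint from it. -/
theorem exists_mem_ne_one_forall_smul_eq {α : StructureLattice G} (hα : α ≠ ⊥) {V : Subgroup G}
    (hV : IsOpen (V : Set G)) :
    ∃ k ∈ V, k ≠ 1 ∧ ∀ β, Disjoint β α → k • β = β := by
  obtain ⟨δ, hδ⟩ := exists_isPerp α
  have hle : ∀ β, Disjoint β α → β ≤ δ := fun β hβ => hδ.le_iff_disjoint.2 hβ
  obtain ⟨U, hU, hUc, K, hKU, hn, rfl, rfl⟩ := hδ
  have hne : K.toSubgroup ⊓ V ≠ ⊥ := fun h => hα (mk_eq_bot_iff.2 ⟨V, hV, h⟩)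
  obtain ⟨k, hk, hk1⟩ := ((K.toSubgroup ⊓ V).bot_or_exists_ne_one).resolve_left hne
  refine ⟨k, hk.2, hk1, fun β hβ => ?_⟩
  have hβ' := hle β hβ
  obtain ⟨J, rfl⟩ := mk_surjective β
  obtain ⟨W, hW, hJW⟩ := mk_le_mk_iff_exists.1 hβ'
  -- The germ of `J` lies in `C_U(K)`, so conjugation by elements of `K` fixes it pointwise.
  have key : ∀ k ∈ K.toSubgroup, mk J ≤ k • mk J := by
    intro k hk
    refine mk_le_mk_of_inf_le hW fun j hj => ?_
    rw [LocallyNormalSubgroup.smul_toSubgroup, Subgroup.mem_pointwise_smul_iff_inv_smul_mem]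
    have hc := Subgroup.mem_centralizer_iff.1 (hJW hj).2 k hk
    have e : (MulAut.conj k)⁻¹ • j = j := by
      have : (MulAut.conj k)⁻¹ • j = k⁻¹ * (j * k) := by simp [MulAut.smul_def, mul_assoc]
      rw [this, ← hc, inv_mul_cancel_left]
    rw [e]
    exact hj.1
  refine le_antisymm ?_ (key k hk.1)
  simpa using smul_le_smul_of_le k (key k⁻¹ (K.toSubgroup.inv_mem hk.1))

theorem exists_mem_centraliserLattice_ne (h : CentraliserLattice G ≠ {⊥, ⊤}) :
    ∃ α ∈ CentraliserLattice G, α ≠ ⊥ ∧ α ≠ ⊤ := by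
  by_contra! hcon
  refine h (Set.Subset.antisymm (fun α hα => ?_) ?_)
  · by_cases hb : α = ⊥
    · exact Or.inl hb
    · exact Or.inr (hcon α hα hb)
  · rintro _ (rfl | rfl)
    · exact bot_mem_centraliserLattice
    · exact top_mem_centraliserLattice

/-- The action on a nontrivial centraliser lattice is faithful. -/
theorem eq_one_of_forall_smul_eq (h : CentraliserLattice G ≠ {⊥, ⊤}) {g : G}
    (hg : ∀ α ∈ CentraliserLattice G, g • α = α) : g = 1 := by
  let N : Subgroup G := ⨅ α : CentraliserLattice G, MulAction.stabilizer G (α : StructureLattice G)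
  have hmem : ∀ x, x ∈ N ↔ ∀ α ∈ CentraliserLattice G, x • α = α := by
    intro x
    simp [N, Subgroup.mem_iInf]
  have hN : N.Normal := by
    constructor
    intro n hn x
    rw [hmem] at hn ⊢
    intro α hα
    have := hn (x⁻¹ • α) (x⁻¹ • (⟨α, hα⟩ : CentraliserLattice G)).2
    rw [mul_smul, mul_smul, this, smul_inv_smul]
  have hclosed : IsClosed (N : Set G) := by
    rw [Subgroup.coe_iInf]
    exact isClosed_iInter fun α => Subgroup.isClosed_of_isOpen _ (isOpen_stabilizer _)
  rcases (IsClassS.topologicallySimple (G := G)).2 N hN hclosed with hbot | htop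
  · have := (hmem g).2 hg
    rw [hbot] at this
    exact this
  · exfalso
    obtain ⟨α, hα, hα0, hα1⟩ := exists_mem_centraliserLattice_ne h
    have hfix : ∀ x : G, x • α = α := fun x => (hmem x).1 (htop ▸ Subgroup.mem_top x) α hα
    obtain ⟨γ, hγ⟩ := hα
    -- Here `α = γ^⊥` is nonzero and invariant, so the disjoint class `γ` vanishes, which forces `α
    -- = ⊤`.
    have hγ0 : γ = ⊥ :=
      eq_bot_of_disjoint_of_smul_eq hα0 hfix (hγ.le_iff_disjoint.1 le_rfl).symm
    exact hα1 (top_le_iff.1 (hγ.le_iff_disjoint.2 (by rw [hγ0]; exact disjoint_bot_right)))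

end StructureLattice

/-! ### The Boolean algebra of pseudo-complements -/

/-- In a meet-semilattice with pseudo-complements `p`, the pseudo-complements form a Boolean
algebra. -/
@[reducible]
def booleanAlgebraOfPseudocomplement {L : Type*} [PartialOrder L] [OrderBot L] (S : Set L)
    (p : L → L) (hp : ∀ a c, c ≤ p a ↔ Disjoint c a) (hS : ∀ a, p a ∈ S)
    (hpp : ∀ a ∈ S, p (p a) = a) (m : L → L → L) (hm : ∀ a b, IsGLB {a, b} (m a b)) :
    BooleanAlgebra S :=
  have hml : ∀ a b, m a b ≤ a := fun a b => (hm a b).1 (Set.mem_insert _ _)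
  have hmr : ∀ a b, m a b ≤ b := fun a b => (hm a b).1 (Set.mem_insert_of_mem _ rfl)
  have hlm : ∀ a b c, c ≤ a → c ≤ b → c ≤ m a b := fun a b c h h' =>
    (hm a b).2 (by rintro _ (rfl | rfl) <;> assumption)
  have hle : ∀ a, a ≤ p (p a) := fun a => (hp _ _).2 ((hp _ _).1 le_rfl).symm
  have hanti : ∀ a b, a ≤ b → p b ≤ p a := fun a b h =>
    (hp _ _).2 (((hp _ _).1 le_rfl).mono_right h)
  have hmS : ∀ a ∈ S, ∀ b ∈ S, m a b ∈ S := fun a ha b hb => by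
    have : p (p (m a b)) = m a b := by
      refine le_antisymm (hlm _ _ _ ?_ ?_) (hle _)
      · exact (hanti _ _ (hanti _ _ (hml a b))).trans (hpp a ha).le
      · exact (hanti _ _ (hanti _ _ (hmr a b))).trans (hpp b hb).le
    rw [← this]
    exact hS _
  -- Residuation: `p (m b (p c))` acts as the implication from `b` to `c`. Distributivity below
  -- follows from this adjunction.
  have hres : ∀ a b, ∀ c ∈ S, m a b ≤ c ↔ a ≤ p (m b (p c)) := fun a b c hc => by
    rw [hp]
    conv_lhs => rw [← hpp c hc, hp]
    constructor
    · intro h x hxa hx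
      exact h (hlm _ _ _ hxa (hx.trans (hml _ _))) (hx.trans (hmr _ _))
    · intro h x hx hxc
      exact h (hx.trans (hml _ _)) (hlm _ _ _ (hx.trans (hmr _ _)) hxc)
  have hcomm : ∀ a b, m a b ≤ m b a := fun a b => hlm _ _ _ (hmr _ _) (hml _ _)
  have hsl : ∀ a b, a ≤ p (m (p a) (p b)) := fun a b => (hle a).trans (hanti _ _ (hml _ _))
  have hsr : ∀ a b, b ≤ p (m (p a) (p b)) := fun a b => (hle b).trans (hanti _ _ (hmr _ _))
  have hsle : ∀ a b, ∀ c ∈ S, a ≤ c → b ≤ c → p (m (p a) (p b)) ≤ c := fun a b c hc h h' =>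
    (hanti _ _ (hlm _ _ _ (hanti _ _ h) (hanti _ _ h'))).trans (hpp c hc).le
  have hbot : p (p ⊥) ≤ ⊥ := ((hp _ _).1 le_rfl) le_rfl ((hp _ _).2 disjoint_bot_right)
  { (inferInstance : PartialOrder S) with
    sup := fun a b => ⟨p (m (p a) (p b)), hS _⟩
    le_sup_left := fun a b => hsl a.1 b.1
    le_sup_right := fun a b => hsr a.1 b.1
    sup_le := fun a b c h h' => hsle a.1 b.1 c.1 c.2 h h'
    inf := fun a b => ⟨m a b, hmS a a.2 b b.2⟩
    inf_le_left := fun a b => hml a.1 b.1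
    inf_le_right := fun a b => hmr a.1 b.1
    le_inf := fun a b c h h' => hlm b.1 c.1 a.1 h h'
    le_sup_inf := by
      rintro ⟨x, hx⟩ ⟨y, hy⟩ ⟨z, hz⟩
      change m (p (m (p x) (p y))) (p (m (p x) (p z))) ≤ p (m (p x) (p (m y z)))
      have hw : p (m (p x) (p (m y z))) ∈ S := hS _
      have hxw : x ≤ p (m (p x) (p (m y z))) := hsl _ _
      have hyzw : m y z ≤ p (m (p x) (p (m y z))) := hsr _ _
      generalize p (m (p x) (p (m y z))) = w at *
      rw [hres _ _ _ hw]
      refine hsle _ _ _ (hS _) ((hres _ _ _ hw).1 ((hml _ _).trans hxw)) ?_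
      refine (hres _ _ _ hw).1 ((hcomm _ _).trans ((hres _ _ _ hw).2 ?_))
      refine hsle _ _ _ (hS _) ((hres _ _ _ hw).1 ((hml _ _).trans hxw)) ?_
      exact (hres _ _ _ hw).1 ((hcomm _ _).trans hyzw)
    compl := fun a => ⟨p a, hS _⟩
    -- `L` has no assumed top and `⊥` is not assumed to lie in `S`, so both bounds are built from
    -- `p`.
    top := ⟨p ⊥, hS _⟩
    bot := ⟨p (p ⊥), hS _⟩
    le_top := fun a => (hp _ _).2 disjoint_bot_right
    bot_le := fun a => show p (p ⊥) ≤ a.1 from hbot.trans bot_le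
    inf_compl_le_bot := fun a =>
      (((hp a.1 _).1 le_rfl).symm (hml _ _) (hmr _ _)).trans bot_le
    top_le_sup_compl := fun a => by
      refine hanti _ _ ?_
      exact (((hp (p a.1) _).1 le_rfl).symm (hml _ _) (hmr _ _)) }

namespace CentraliserLattice

open StructureLattice

variable (G : Type*) [Group G] [TopologicalSpace G] [IsClassS G]

/-- The centraliser lattice of a group of class `𝒮` is a Boolean algebra. -/
@[reducible]
noncomputable def booleanAlgebra : BooleanAlgebra (CentraliserLattice G) :=
  have hp : ∀ a c : StructureLattice G, c ≤ (exists_isPerp a).choose ↔ Disjoint c a :=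
    fun a _ => (exists_isPerp a).choose_spec.le_iff_disjoint
  booleanAlgebraOfPseudocomplement (CentraliserLattice G) (fun a => (exists_isPerp a).choose) hp
    (fun a => ⟨a, (exists_isPerp a).choose_spec⟩)
    (fun a ha => by
      obtain ⟨γ, hγ⟩ := ha
      have h1 : γ ≤ (exists_isPerp a).choose :=
        (hp _ _).2 (hγ.le_iff_disjoint.1 le_rfl).symm
      refine le_antisymm (hγ.le_iff_disjoint.2 ?_) ?_
      · exact ((hp _ _).1 le_rfl).mono_right h1
      · exact (hp _ _).2 ((hp _ _).1 le_rfl).symm)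
    (fun a b => (exists_isGLB_pair a b).choose) (fun a b => (exists_isGLB_pair a b).choose_spec)

end CentraliserLattice

/-! ### Group actions on Boolean algebras -/

section BooleanAction

variable {B G : Type*} [BooleanAlgebra B] [Group G] [MulAction G B]
  [CovariantClass G B (· • ·) (· ≤ ·)]

/-- The order automorphism of a Boolean algebra given by a group element. -/
def smulOrderIso (B : Type*) [BooleanAlgebra B] [MulAction G B]
    [CovariantClass G B (· • ·) (· ≤ ·)] (g : G) : B ≃o B where
  toEquiv := MulAction.toPerm g
  map_rel_iff' {a b} := by
    refine ⟨fun h => ?_, fun h => StoneSpace.smul_le_smul_of_le g h⟩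
    simpa using StoneSpace.smul_le_smul_of_le g⁻¹ h

theorem smul_le_smul_iff_of_covariant (g : G) {a b : B} : g • a ≤ g • b ↔ a ≤ b :=
  (smulOrderIso B g).le_iff_le

theorem smul_le_iff_le_inv_smul (g : G) {a b : B} : g • a ≤ b ↔ a ≤ g⁻¹ • b := by
  rw [← smul_le_smul_iff_of_covariant g (b := g⁻¹ • b), smul_inv_smul]

theorem smul_inf_of_covariant (g : G) (a b : B) : g • (a ⊓ b) = g • a ⊓ g • b :=
  map_inf (smulOrderIso B g) a b

theorem smul_bot_of_covariant (g : G) : g • (⊥ : B) = ⊥ := map_bot (smulOrderIso B g)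

theorem smul_eq_bot_iff_of_covariant (g : G) {a : B} : g • a = ⊥ ↔ a = ⊥ := by
  rw [smul_eq_iff_eq_inv_smul, smul_bot_of_covariant]

theorem disjoint_smul_smul_iff (g : G) {a b : B} : Disjoint (g • a) (g • b) ↔ Disjoint a b := by
  rw [disjoint_iff, disjoint_iff, ← smul_inf_of_covariant, smul_eq_bot_iff_of_covariant]

theorem disjoint_smul_left_iff (g : G) {a b : B} : Disjoint (g • a) b ↔ Disjoint a (g⁻¹ • b) := by
  rw [← disjoint_smul_smul_iff g (b := g⁻¹ • b), smul_inv_smul]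

/-- A group element that moves some element of a Boolean algebra moves some nonzero element off
itself. -/
theorem exists_disjoint_smul {g : G} {a : B} (h : g • a ≠ a) :
    ∃ d : B, d ≠ ⊥ ∧ Disjoint (g • d) d := by
  -- The part of `a` outside `g • a` works if nonzero. Otherwise `a < g • a`, and the preimage of `g
  -- • a ⊓ aᶜ` lies in `a` and is carried off `a`.
  by_cases h1 : a ⊓ (g • a)ᶜ = ⊥
  · have h2 : a ≤ g • a := by rwa [← disjoint_iff, disjoint_compl_right_iff] at h1
    have h3 : ¬ g • a ≤ a := fun h' => h (le_antisymm h' h2)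
    refine ⟨g⁻¹ • (g • a ⊓ aᶜ), ?_, ?_⟩
    · rw [Ne, smul_eq_bot_iff_of_covariant, ← disjoint_iff, disjoint_compl_right_iff]
      exact h3
    · rw [smul_inv_smul]
      refine Disjoint.mono inf_le_right ?_ (disjoint_compl_left (a := a))
      rw [smul_le_iff_le_inv_smul, inv_inv]
      exact inf_le_left
  · refine ⟨_, h1, Disjoint.mono ?_ inf_le_right (disjoint_compl_right (a := g • a))⟩
    exact (smul_le_smul_iff_of_covariant g).2 inf_le_left

/-- Up to translation, every nonzero element lies above one of finitely many nonzero elements. -/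
theorem exists_finset_forall_exists_le_smul [TopologicalSpace G] [IsClassS G]
    (hstab : ∀ a : B, IsOpen (MulAction.stabilizer G a : Set G))
    (hfaith : ∀ g : G, (∀ a : B, g • a = a) → g = 1)
    (hrist : ∀ a : B, a ≠ ⊥ → ∀ V : Subgroup G, IsOpen (V : Set G) →
      ∃ k ∈ V, k ≠ 1 ∧ ∀ b : B, Disjoint b a → k • b = b) :
    ∃ D : Finset B, (∀ d ∈ D, d ≠ ⊥) ∧ ∀ a : B, a ≠ ⊥ → ∃ g : G, ∃ d ∈ D, d ≤ g • a := by
  classical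
  obtain ⟨U, hU, hUc⟩ := exists_compact_open_subgroup G
  obtain ⟨S, hSf, -, hS⟩ := Subgroup.exists_finite_closure_union_eq_top
    (IsClassS.compactlyGenerated (G := G)) (Q := ⊤) (U := U) dense_univ hU
  -- `C` consists of the elements of `U` that leave `U` after conjugation by a single generator. It
  -- is compact and avoids `1`.
  let C : Set G := ⋃ s ∈ S ∪ S⁻¹, (U : Set G) ∩ ((MulAut.conj s • U : Subgroup G) : Set G)ᶜ
  have hC : IsCompact C := (hSf.union hSf.inv).isCompact_biUnion fun s _ =>
    hUc.inter_right (LocallyNormalSubgroup.isOpen_conj s hU).isClosed_compl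
  have hC1 : ∀ k ∈ C, k ≠ 1 := by
    rintro k hk rfl
    obtain ⟨s, -, -, hks⟩ := Set.mem_iUnion₂.1 hk
    exact hks (Subgroup.one_mem _)
  have hmove : ∀ k ∈ C, ∃ d : B, d ≠ ⊥ ∧ Disjoint (k • d) d := by
    intro k hk
    have : ∃ a : B, k • a ≠ a := by
      by_contra! h
      exact hC1 k hk (hfaith k h)
    obtain ⟨a, ha⟩ := this
    exact exists_disjoint_smul ha
  choose! d hd0 hd using hmove
  -- The coset `k * stabilizer (d k)` is open and its elements act on `d k` as `k` does, so finitely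
  -- many `d k` serve all of `C`.
  obtain ⟨t, htC, ht⟩ := hC.elim_nhds_subcover
    (fun k => (fun x => k⁻¹ * x) ⁻¹' (MulAction.stabilizer G (d k) : Set G))
    (fun k _ => ((hstab (d k)).preimage (continuous_const_mul k⁻¹)).mem_nhds (by simp))
  have hdet : ∀ a : B, a ≠ ⊥ → ∃ g : G, ∃ k ∈ C, ∀ b : B, Disjoint b (g • a) → k • b = b := by
    intro a ha
    by_contra! hcon
    obtain ⟨k, hkU, hk1, hk⟩ := hrist a ha U hU
    -- If no conjugate of `k` met `C`, then moving along the generators could never take a conjugate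
    -- of `k` out of `U`. So `k` would lie in the normal core of `U`, which is compact and hence
    -- trivial.
    have hall : ∀ x : G, k ∈ MulAut.conj x • U := by
      have hstep : ∀ x y : G, y ∈ S ∪ S⁻¹ → k ∈ MulAut.conj x • U →
          k ∈ MulAut.conj (x * y) • U := by
        intro x y hy hkx
        rw [map_mul, mul_smul, Subgroup.mem_pointwise_smul_iff_inv_smul_mem]
        rw [Subgroup.mem_pointwise_smul_iff_inv_smul_mem] at hkx
        by_contra hky
        obtain ⟨b, hb, hne⟩ := hcon x⁻¹ _ (Set.mem_iUnion₂.2 ⟨y, hy, hkx, hky⟩)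
        have hxb : k • x • b = x • b := by
          apply hk
          rwa [disjoint_smul_left_iff]
        apply hne
        have e : (MulAut.conj x)⁻¹ • k = x⁻¹ * k * x := by simp [MulAut.smul_def]
        rw [e, mul_smul, mul_smul, hxb, inv_smul_smul]
      have hstepU : ∀ x : G, ∀ y ∈ U, k ∈ MulAut.conj x • U → k ∈ MulAut.conj (x * y) • U := by
        intro x y hy hkx
        rw [map_mul, mul_smul, Subgroup.conj_smul_eq_self_of_mem hy]
        exact hkx
      intro x
      have hx : x ∈ Subgroup.closure ((U : Set G) ∪ S) := by rw [hS]; trivial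
      induction hx using Subgroup.closure_induction_right with
      | one => simpa using hkU
      | mul_right x _ y hy ih =>
        exact hy.elim (fun hy => hstepU x y hy ih) fun hy => hstep x y (Or.inl hy) ih
      | mul_inv_cancel x _ y hy ih =>
        exact hy.elim (fun hy => hstepU x y⁻¹ (U.inv_mem hy) ih) fun hy =>
          hstep x y⁻¹ (Or.inr (Set.inv_mem_inv.2 hy)) ih
    have hcore : U.normalCore = ⊥ := IsClassS.eq_bot_of_normal_of_isCompact inferInstance
      (hUc.of_isClosed_subset (U.normalCore_isClosed (U.isClosed_of_isOpen hU))
        U.normalCore_le)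
    refine hk1 ((Subgroup.eq_bot_iff_forall _).1 hcore k fun x => ?_)
    have := Subgroup.mem_pointwise_smul_iff_inv_smul_mem.1 (hall x⁻¹)
    simpa [MulAut.smul_def] using this
  refine ⟨t.image d, fun x hx => ?_, fun a ha => ?_⟩
  · obtain ⟨k, hk, rfl⟩ := Finset.mem_image.1 hx
    exact hd0 k (htC k hk)
  · obtain ⟨g, k, hkC, hk⟩ := hdet a ha
    obtain ⟨k', hk't, hk'⟩ := Set.mem_iUnion₂.1 (ht hkC)
    have hkd : k • d k' = k' • d k' := by
      have : (k'⁻¹ * k) • d k' = d k' := hk'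
      rwa [mul_smul, inv_smul_eq_iff] at this
    refine ⟨g, d k', Finset.mem_image_of_mem d hk't, ?_⟩
    -- The part of `d k'` outside `g • a` is fixed by `k` and also disjoint from its image under
    -- `k`; hence it is zero.
    have h1 : k • (d k' ⊓ (g • a)ᶜ) = d k' ⊓ (g • a)ᶜ :=
      hk _ (Disjoint.mono_left inf_le_right disjoint_compl_left)
    have h2 : Disjoint (k • (d k' ⊓ (g • a)ᶜ)) (d k' ⊓ (g • a)ᶜ) := by
      refine Disjoint.mono ?_ inf_le_left (hd k' (htC k' hk't))
      rw [← hkd]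
      exact (smul_le_smul_iff_of_covariant k).2 inf_le_left
    rw [h1, disjoint_self, ← disjoint_iff, disjoint_compl_right_iff] at h2
    exact h2

/-- If every nonzero element lies, up to translation, above one of finitely many nonzero elements,
and finitely many translates of any nonzero element cover, then a single element suffices. -/
theorem exists_forall_exists_smul_le [Nontrivial B]
    (hcover : ∀ a : B, a ≠ ⊥ → ∃ F : Finset G, ∀ b, (∀ g ∈ F, Disjoint b (g • a)) → b = ⊥)
    (D : Finset B) (hD : ∀ d ∈ D, d ≠ ⊥)
    (h : ∀ a : B, a ≠ ⊥ → ∃ g : G, ∃ d ∈ D, g • d ≤ a) :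
    ∃ d : B, d ≠ ⊥ ∧ ∀ a : B, a ≠ ⊥ → ∃ g : G, g • d ≤ a := by
  classical
  induction D using Finset.induction_on with
  | empty =>
    obtain ⟨g, d, hd, -⟩ := h ⊤ top_ne_bot
    simp at hd
  | insert d D _ ih =>
    by_cases hd : ∀ a : B, a ≠ ⊥ → ∃ g : G, g • d ≤ a
    · exact ⟨d, hD d (Finset.mem_insert_self _ _), hd⟩
    · push Not at hd
      obtain ⟨a, ha, hda⟩ := hd
      refine ih (fun x hx => hD x (Finset.mem_insert_of_mem hx)) fun b hb => ?_
      obtain ⟨F, hF⟩ := hcover a ha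
      -- No translate of `d` lies below `a`, hence none below `g • a`. So an element with a
      -- translate below `b ⊓ g • a` comes from the rest of `D`, and `d` can be dropped.
      have : ∃ g ∈ F, b ⊓ g • a ≠ ⊥ := by
        by_contra! hcon
        exact hb (hF b fun g hg => disjoint_iff.2 (hcon g hg))
      obtain ⟨g, -, hg⟩ := this
      obtain ⟨x, e, he, hx⟩ := h _ hg
      rcases Finset.mem_insert.1 he with rfl | he
      · refine absurd ?_ (hda (g⁻¹ * x))
        rw [mul_smul, smul_le_iff_le_inv_smul, inv_inv]
        exact hx.trans inf_le_right
      · exact ⟨x, e, he, hx.trans inf_le_left⟩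

end BooleanAction

/-! ### The Stone space of a Boolean algebra -/

namespace StoneSpace

section Boolean

variable {B : Type*} [BooleanAlgebra B]

theorem top_mem (x : StoneSpace B) : ⊤ ∈ x.1 := Order.PFilter.top_mem

theorem mem_of_le {x : StoneSpace B} {a b : B} (h : a ≤ b) (ha : a ∈ x.1) : b ∈ x.1 :=
  Order.PFilter.mem_of_le h ha

theorem inf_mem_iff {x : StoneSpace B} {a b : B} : a ⊓ b ∈ x.1 ↔ a ∈ x.1 ∧ b ∈ x.1 :=
  Order.PFilter.inf_mem_iff

theorem sup_mem_iff {x : StoneSpace B} {a b : B} : a ⊔ b ∈ x.1 ↔ a ∈ x.1 ∨ b ∈ x.1 := by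
  constructor
  · intro h
    by_contra! hcon
    have ha : a ∈ x.2.compl_ideal.toIdeal := hcon.1
    have hb : b ∈ x.2.compl_ideal.toIdeal := hcon.2
    exact (Order.Ideal.sup_mem ha hb : a ⊔ b ∈ x.2.compl_ideal.toIdeal) h
  · rintro (h | h)
    · exact mem_of_le le_sup_left h
    · exact mem_of_le le_sup_right h

theorem bot_notMem (x : StoneSpace B) : ⊥ ∉ x.1 :=
  (Order.Ideal.bot_mem x.2.compl_ideal.toIdeal : ⊥ ∈ x.2.compl_ideal.toIdeal)

theorem ne_bot_of_mem {x : StoneSpace B} {a : B} (h : a ∈ x.1) : a ≠ ⊥ :=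
  fun h' => bot_notMem x (h' ▸ h)

theorem compl_mem_iff {x : StoneSpace B} {a : B} : aᶜ ∈ x.1 ↔ a ∉ x.1 := by
  constructor
  · intro h h'
    have := inf_mem_iff.2 ⟨h', h⟩
    rw [inf_compl_self] at this
    exact bot_notMem x this
  · intro h
    have := top_mem x
    rw [← sup_compl_eq_top (x := a), sup_mem_iff] at this
    exact this.resolve_left h

theorem finset_sup_mem_iff {ι : Type*} {x : StoneSpace B} {F : Finset ι} {f : ι → B} :
    F.sup f ∈ x.1 ↔ ∃ i ∈ F, f i ∈ x.1 := by
  classical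
  induction F using Finset.induction_on with
  | empty => simp [bot_notMem]
  | insert i F _ ih => simp [sup_mem_iff, ih]

theorem finset_inf_mem_iff {ι : Type*} {x : StoneSpace B} {F : Finset ι} {f : ι → B} :
    F.inf f ∈ x.1 ↔ ∀ i ∈ F, f i ∈ x.1 := by
  classical
  induction F using Finset.induction_on with
  | empty => simp
  | insert i F _ ih => simp [ih]

/-- The Stone space is compact: a family covers it only if finitely many of its members do. -/
theorem exists_finset_sup_eq_top {s : Set B} (h : ∀ x : StoneSpace B, ∃ a ∈ s, a ∈ x.1) :
    ∃ t : Finset B, (t : Set B) ⊆ s ∧ t.sup id = ⊤ := by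
  classical
  by_contra! hcon
  -- If no finite join is `⊤`, the ideal generated by `s` is proper. A prime ideal containing it has
  -- as complement a prime filter missing `s`.
  have hI : Order.IsIdeal {b : B | ∃ t : Finset B, (t : Set B) ⊆ s ∧ b ≤ t.sup id} := by
    refine ⟨?_, ⟨⊥, ∅, by simp, bot_le⟩, ?_⟩
    · rintro a b hab ⟨t, ht, hat⟩
      exact ⟨t, ht, hab.trans hat⟩
    · rintro a ⟨t, ht, hat⟩ b ⟨u, hu, hbu⟩
      refine ⟨a ⊔ b, ⟨t ∪ u, ?_, ?_⟩, le_sup_left, le_sup_right⟩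
      · rw [Finset.coe_union]
        exact Set.union_subset ht hu
      · rw [Finset.sup_union]
        exact sup_le_sup hat hbu
  have hdis : Disjoint ((Order.PFilter.principal (⊤ : B) : Order.PFilter B) : Set B)
      (hI.toIdeal : Set B) := by
    rw [Set.disjoint_left]
    rintro a ha ⟨t, ht, hat⟩
    have ha' : ⊤ ≤ a := ha
    exact hcon t ht (top_le_iff.1 (ha'.trans hat))
  obtain ⟨J, hJ, hIJ, -⟩ := DistribLattice.prime_ideal_of_disjoint_filter_ideal hdis
  obtain ⟨a, has, ha⟩ := h ⟨hJ.toPrimePair.F, hJ.toPrimePair.F_isPrime⟩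
  have haJ : a ∈ J := hIJ (⟨{a}, by simpa using has, by simp⟩ : a ∈ hI.toIdeal)
  exact (ha : a ∈ (J : Set B)ᶜ) haJ

theorem exists_mem_of_ne_bot {a : B} (ha : a ≠ ⊥) : ∃ x : StoneSpace B, a ∈ x.1 := by
  by_contra! hcon
  obtain ⟨t, ht, hsup⟩ := exists_finset_sup_eq_top (s := {aᶜ})
    fun x => ⟨aᶜ, rfl, compl_mem_iff.2 (hcon x)⟩
  have : t.sup id ≤ aᶜ := Finset.sup_le fun b hb => (Set.mem_singleton_iff.1 (ht hb)).le
  rw [hsup, top_le_iff, compl_eq_top] at this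
  exact ha this

theorem le_of_forall_mem {a b : B} (h : ∀ x : StoneSpace B, a ∈ x.1 → b ∈ x.1) : a ≤ b := by
  by_contra hab
  rw [← disjoint_compl_right_iff, disjoint_iff] at hab
  obtain ⟨x, hx⟩ := exists_mem_of_ne_bot hab
  exact compl_mem_iff.1 (inf_mem_iff.1 hx).2 (h x (inf_mem_iff.1 hx).1)

theorem ext_of_forall_mem {x y : StoneSpace B} (h : ∀ a ∈ x.1, a ∈ y.1) : x = y := by
  apply Subtype.ext
  apply SetLike.ext
  refine fun a => ⟨h a, fun ha => ?_⟩
  by_contra hax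
  exact compl_mem_iff.1 (h _ (compl_mem_iff.2 hax)) ha

theorem isTopologicalBasis_basicSet :
    TopologicalSpace.IsTopologicalBasis (Set.range (basicSet : B → Set (StoneSpace B))) where
  exists_subset_inter := by
    rintro _ ⟨a, rfl⟩ _ ⟨b, rfl⟩ x hx
    exact ⟨_, ⟨a ⊓ b, rfl⟩, inf_mem_iff.2 hx, fun y hy => inf_mem_iff.1 hy⟩
  sUnion_eq := Set.eq_univ_of_forall fun x => ⟨_, ⟨⊤, rfl⟩, top_mem x⟩
  eq_generateFrom := rfl

theorem isOpen_basicSet (a : B) : IsOpen (basicSet a) :=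
  isTopologicalBasis_basicSet.isOpen ⟨a, rfl⟩

theorem isClosed_basicSet (a : B) : IsClosed (basicSet a) := by
  have : (basicSet a)ᶜ = basicSet aᶜ := Set.ext fun x => compl_mem_iff.symm
  rw [← isOpen_compl_iff, this]
  exact isOpen_basicSet _

theorem exists_basicSet_subset {x : StoneSpace B} {W : Set (StoneSpace B)} (hW : W ∈ 𝓝 x) :
    ∃ a ∈ x.1, basicSet a ⊆ W := by
  obtain ⟨_, ⟨a, rfl⟩, ha, haW⟩ := isTopologicalBasis_basicSet.mem_nhds_iff.1 hW
  exact ⟨a, ha, haW⟩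

theorem basicSet_mono {a b : B} (h : a ≤ b) : basicSet a ⊆ basicSet b :=
  fun _ hx => mem_of_le h hx

/-- The finitely many covering translates have join `⊤`, and a prime filter containing a finite join
contains one of its terms. -/
theorem exists_smul_mem {G : Type*} [Group G] [MulAction G B]
    (hcover : ∀ a : B, a ≠ ⊥ → ∃ F : Finset G, ∀ b, (∀ g ∈ F, Disjoint b (g • a)) → b = ⊥)
    {a : B} (ha : a ≠ ⊥) (x : StoneSpace B) : ∃ g : G, g • a ∈ x.1 := by
  obtain ⟨F, hF⟩ := hcover a ha
  have hbot : (F.sup fun g => g • a)ᶜ = ⊥ := hF _ fun g hg =>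
    Disjoint.mono_right (Finset.le_sup (f := fun g => g • a) hg) disjoint_compl_left
  have : (F.sup fun g => g • a) ∈ x.1 := by
    rw [compl_eq_bot.1 hbot]
    exact top_mem x
  obtain ⟨g, -, hg⟩ := finset_sup_mem_iff.1 this
  exact ⟨g, hg⟩

end Boolean

/-! ### Group actions on Stone spaces -/

section Action

variable {B G : Type*} [BooleanAlgebra B] [Group G] [MulAction G B]
  [CovariantClass G B (· • ·) (· ≤ ·)]

theorem smul_mem_smul_iff (g : G) {x : StoneSpace B} {a : B} : g • a ∈ (g • x).1 ↔ a ∈ x.1 := by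
  rw [mem_smul_iff, inv_smul_smul]

theorem smul_mem_iff (g : G) {x : StoneSpace B} {a : B} : g • a ∈ x.1 ↔ a ∈ (g⁻¹ • x).1 := by
  rw [mem_smul_iff, inv_inv]

theorem smul_basicSet (g : G) (a : B) : g • basicSet a = basicSet (g • a) := by
  ext x
  rw [Set.mem_smul_set_iff_inv_smul_mem]
  exact (smul_mem_iff g).symm

theorem isMinimal
    (hcover : ∀ a : B, a ≠ ⊥ → ∃ F : Finset G, ∀ b, (∀ g ∈ F, Disjoint b (g • a)) → b = ⊥) :
    MulAction.IsMinimal G (StoneSpace B) where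
  dense_orbit x := by
    refine isTopologicalBasis_basicSet.dense_iff.2 ?_
    rintro _ ⟨a, rfl⟩ ⟨y, hy⟩
    obtain ⟨g, hg⟩ := exists_smul_mem hcover (ne_bot_of_mem hy) x
    exact ⟨g⁻¹ • x, (smul_mem_iff g).1 hg, g⁻¹, rfl⟩

theorem continuousSMul [TopologicalSpace G] [IsTopologicalGroup G]
    (hstab : ∀ a : B, IsOpen (MulAction.stabilizer G a : Set G)) :
    ContinuousSMul G (StoneSpace B) where
  continuous_smul := by
    refine continuous_generateFrom_iff.2 ?_
    rintro _ ⟨a, rfl⟩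
    refine isOpen_iff_mem_nhds.2 ?_
    rintro ⟨g, x⟩ hgx
    have h1 : (fun h : G => g * h⁻¹) ⁻¹' (MulAction.stabilizer G a : Set G) ∈ 𝓝 g :=
      ((hstab a).preimage (by fun_prop)).mem_nhds (by simp)
    have h2 : basicSet (g⁻¹ • a) ∈ 𝓝 x := (isOpen_basicSet _).mem_nhds hgx
    filter_upwards [prod_mem_nhds h1 h2]
    rintro ⟨h, y⟩ ⟨hh, hy⟩
    have e : h⁻¹ • a = g⁻¹ • a := by
      have : (g * h⁻¹) • a = a := hh
      rw [eq_inv_smul_iff, ← mul_smul, this]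
    change h⁻¹ • a ∈ y.1
    rw [e]
    exact hy

theorem faithfulSMul (hfaith : ∀ g : G, (∀ a : B, g • a = a) → g = 1) :
    FaithfulSMul G (StoneSpace B) where
  eq_of_smul_eq_smul {g h} hgh := by
    have : h⁻¹ * g = 1 := by
      refine hfaith _ fun a => ?_
      have key : ∀ x : StoneSpace B, (h⁻¹ * g) • a ∈ x.1 ↔ a ∈ x.1 := by
        intro x
        rw [smul_mem_iff, mul_inv_rev, inv_inv, mul_smul, ← smul_mem_smul_iff g, smul_inv_smul,
          ← hgh, smul_mem_smul_iff]
      exact le_antisymm (le_of_forall_mem fun x => (key x).1)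
        (le_of_forall_mem fun x => (key x).2)
    rwa [inv_mul_eq_one, eq_comm] at this

/-- Below any `a ∈ x` lies `a ⊓ eᶜ ∈ x`, which `k` fixes. Inclusion of prime filters is already
equality. -/
theorem smul_eq_of_notMem {k : G} {e : B} (hk : ∀ b : B, Disjoint b e → k • b = b)
    {x : StoneSpace B} (hx : e ∉ x.1) : k • x = x := by
  symm
  refine ext_of_forall_mem fun a ha => ?_
  have h1 : a ⊓ eᶜ ∈ x.1 := inf_mem_iff.2 ⟨ha, compl_mem_iff.2 hx⟩
  have h2 := hk (a ⊓ eᶜ) (Disjoint.mono_left inf_le_right disjoint_compl_left)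
  rw [← smul_mem_smul_iff k, h2] at h1
  exact (inf_mem_iff.1 h1).1

/-- Any two points can be moved simultaneously into the set defined by `d`. -/
theorem exists_smul_mem_and_smul_mem [TopologicalSpace G] [IsClassS G]
    (hstab : ∀ a : B, IsOpen (MulAction.stabilizer G a : Set G))
    (hcover : ∀ a : B, a ≠ ⊥ → ∃ F : Finset G, ∀ b, (∀ g ∈ F, Disjoint b (g • a)) → b = ⊥)
    {d : B} (hd : d ≠ ⊥) (hrist : ∃ k : G, k ≠ 1 ∧ ∀ b : B, Disjoint b d → k • b = b)
    (x z : StoneSpace B) : ∃ g : G, g • d ∈ x.1 ∧ g • d ∈ z.1 := by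
  by_contra! hxz
  -- `R` is the closed set of points sharing no translate of `d` with `z`; it contains `x`.
  let R : Set (StoneSpace B) := {y | ∀ g : G, g • d ∈ y.1 → g • d ∉ z.1}
  have hRc : IsClosed R := by
    have : R = ⋂ g : G, {y | g • d ∈ y.1 → g • d ∉ z.1} := by
      ext y
      simp [R]
    rw [this]
    refine isClosed_iInter fun g => ?_
    by_cases hg : g • d ∈ z.1
    · simp only [hg, not_true_eq_false, imp_false]
      exact (isOpen_basicSet (g • d)).isClosed_compl
    · simp [hg]
  have hRk : ∀ (k g : G), (∀ b : B, Disjoint b (g • d) → k • b = b) → ∀ y ∈ R, k • y ∈ R := by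
    intro k g hk y hy
    -- Let `k` be supported on `g • d`. If `z` lies there, then `y ∈ R` does not and `k` fixes `y`.
    -- Otherwise `k` fixes `z`, so it preserves the relation defining `R`.
    by_cases hgz : g • d ∈ z.1
    · rwa [smul_eq_of_notMem hk fun h => hy g h hgz]
    · intro h hh hhz
      rw [← smul_eq_of_notMem hk hgz] at hhz
      rw [mem_smul_iff, ← mul_smul] at hh hhz
      exact hy _ hh hhz
  let N : Subgroup G := Subgroup.normalClosure {k | ∀ b : B, Disjoint b d → k • b = b}
  have hN : N ≠ ⊥ := by
    obtain ⟨k, hk1, hk⟩ := hrist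
    intro h
    have : k ∈ N := Subgroup.subset_normalClosure hk
    rw [h] at this
    exact hk1 this
  have hNR : N ≤ MulAction.stabilizer G R := by
    refine (Subgroup.closure_le _).2 fun c hc => ?_
    obtain ⟨k, hk, hkc⟩ := Group.mem_conjugatesOfSet_iff.1 hc
    obtain ⟨g, rfl⟩ := isConj_iff.1 hkc
    have h1 : ∀ b : B, Disjoint b (g • d) → (g * k * g⁻¹) • b = b := by
      intro b hb
      have := hk (g⁻¹ • b) (by rwa [disjoint_smul_left_iff, inv_inv])
      rw [mul_smul, mul_smul, this, smul_inv_smul]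
    have h2 : ∀ b : B, Disjoint b (g • d) → (g * k * g⁻¹)⁻¹ • b = b := fun b hb =>
      inv_smul_eq_iff.2 (h1 b hb).symm
    refine MulAction.mem_stabilizer_set.2 fun y => ⟨fun hy => ?_, hRk _ g h1 y⟩
    simpa only [inv_smul_smul] using hRk _ g h2 _ hy
  have hcont := continuousSMul hstab
  -- The dense normal subgroup `N` stabilises `R`; as `R` is closed and orbit maps are continuous,
  -- it contains the whole orbit of `x`. But some translate of `x` shares a translate of `d` with
  -- `z`.
  have hall : ∀ g : G, g • x ∈ R := by
    have hcl : IsClosed {g : G | g • x ∈ R} := hRc.preimage (by fun_prop)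
    have hsub : closure (N : Set G) ⊆ {g : G | g • x ∈ R} :=
      closure_minimal (fun g hg => (MulAction.mem_stabilizer_set.1 (hNR hg) x).2 hxz) hcl
    intro g
    exact hsub (IsClassS.dense_of_normal Subgroup.normalClosure_normal hN g)
  obtain ⟨g, hg⟩ := exists_smul_mem hcover hd z
  obtain ⟨h, hh⟩ := exists_smul_mem hcover hd x
  refine hall (g * h⁻¹) g ?_ hg
  rw [mul_smul, smul_mem_smul_iff, ← smul_mem_smul_iff h, smul_inv_smul]
  exact hh

end Action

end StoneSpace

/-! ### Compressibility and strong proximality -/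

/-- Translates that are eventually contained in every neighbourhood of `x` exhibit compressibility
to `x`. -/
theorem isCompressible_of_forall_nhds {G X : Type*} [Group G] [TopologicalSpace X] [MulAction G X]
    {V : Set X} (hV : IsClosed V) (hne : V.Nonempty) {x : X}
    (h : ∀ W ∈ 𝓝 x, ∃ g : G, g • V ⊆ W) : IsCompressible G V := by
  let τ := TopologicalSpace.vietoris X
  refine ⟨hV, comap (fun g : G => g • V) (𝓝 {x}), x, ?_, tendsto_comap⟩
  have hmono : Monotone fun W : Set X => {A : Set X | A ⊆ W ∧ A.Nonempty} :=
    fun W W' hWW' A hA => ⟨hA.1.trans hWW', hA.2⟩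
  -- Containment in `W` handles both kinds of subbasic Vietoris sets around `{x}`; the hitting sets
  -- also need `A` nonempty.
  have hle : (𝓝 x).lift' (fun W => {A : Set X | A ⊆ W ∧ A.Nonempty}) ≤ 𝓝 ({x} : Set X) := by
    rw [TopologicalSpace.nhds_generateFrom]
    refine le_iInf₂ fun s hs => le_principal_iff.2 ?_
    rw [mem_lift'_sets hmono]
    obtain ⟨hxs, ⟨W, hW, rfl⟩ | ⟨W, hW, rfl⟩⟩ := hs
    · exact ⟨W, hW.mem_nhds (Set.singleton_subset_iff.1 hxs), fun A hA => hA.1⟩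
    · have hxW : x ∈ W := by
        obtain ⟨y, rfl, hy⟩ := hxs
        exact hy
      refine ⟨W, hW.mem_nhds hxW, fun A hA => ?_⟩
      obtain ⟨y, hy⟩ := hA.2
      exact ⟨y, hy, hA.1 hy⟩
  refine comap_neBot_iff.2 fun t ht => ?_
  obtain ⟨W, hW, hWt⟩ := (mem_lift'_sets hmono).1 (hle ht)
  obtain ⟨g, hg⟩ := h W hW
  exact ⟨g, hWt ⟨hg, hne.smul_set⟩⟩

/-- A Dirac mass lies in the closure of the orbit of `μ` if almost all of the mass of `μ` can be
moved into any neighbourhood of the point. -/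
theorem diracProba_mem_closure_of_forall_nhds {G X : Type*} [Group G] [TopologicalSpace X]
    [MeasurableSpace X] [BorelSpace X] [MulAction G X] [ContinuousConstSMul G X]
    (μ : ProbabilityMeasure X) (x : X)
    (h : ∀ W ∈ 𝓝 x, ∀ ε : ℝ, 0 < ε → ∃ g : G, (μ : Measure X).real {y | g • y ∉ W} ≤ ε) :
    diracProba x ∈ closure (Set.range fun g : G =>
      μ.map (f := fun y : X => g • y) (continuous_const_smul g).measurable.aemeasurable) := by
  choose! g hg using h
  -- The net is indexed by shrinking neighbourhoods and tolerances `1 / (n + 1)`. The principal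
  -- filter discards small sets that are not neighbourhoods of `x`.
  let l : Filter (Set X × ℕ) := ((𝓝 x).smallSets ⊓ 𝓟 {W | W ∈ 𝓝 x}) ×ˢ atTop
  have hl : ((𝓝 x).smallSets ⊓ 𝓟 {W : Set X | W ∈ 𝓝 x}).NeBot := by
    rw [((𝓝 x).basis_sets.smallSets.inf_principal _).neBot_iff]
    exact fun {W} hW => ⟨W, Set.mem_powerset subset_rfl, hW⟩
  refine mem_closure_of_tendsto (b := l)
    (f := fun p => μ.map (f := fun y : X => g p.1 (1 / (p.2 + 1 : ℝ)) • y)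
      (continuous_const_smul _).measurable.aemeasurable) ?_
    (Eventually.of_forall fun p => ⟨_, rfl⟩)
  rw [ProbabilityMeasure.tendsto_iff_forall_integral_tendsto]
  intro f
  have hdirac : ∫ y, f y ∂(diracProba x : Measure X) = f x := by
    change ∫ y, f y ∂(Measure.dirac x) = f x
    exact integral_dirac' _ _ f.continuous.measurable.stronglyMeasurable
  rw [hdirac, Metric.tendsto_nhds]
  intro ε hε
  let W : Set X := {y | dist (f y) (f x) < ε / 2}
  have hWo : IsOpen W := isOpen_lt (by fun_prop) continuous_const
  have hW : W ∈ 𝓝 x := hWo.mem_nhds (by simp [W, hε])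
  have hlim : ∀ᶠ n : ℕ in atTop, 2 * ‖f‖ * (1 / (n + 1 : ℝ)) < ε / 2 := by
    have : Tendsto (fun n : ℕ => 2 * ‖f‖ * (1 / (n + 1 : ℝ))) atTop (𝓝 (2 * ‖f‖ * 0)) :=
      tendsto_one_div_add_atTop_nhds_zero_nat.const_mul _
    rw [mul_zero] at this
    exact this.eventually_lt_const (half_pos hε)
  have hsets : ∀ᶠ W' in (𝓝 x).smallSets ⊓ 𝓟 {W : Set X | W ∈ 𝓝 x}, W' ⊆ W ∧ W' ∈ 𝓝 x := by
    rw [eventually_inf_principal]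
    filter_upwards [eventually_smallSets_subset.2 hW] with W' h1 h2 using ⟨h1, h2⟩
  filter_upwards [hsets.prod_mk hlim]
  rintro ⟨W', n⟩ ⟨⟨hsub, hW'⟩, hn⟩
  simp only at hn hsub hW' ⊢
  have hgn := hg W' hW' (1 / (n + 1 : ℝ)) (by positivity)
  set γ : G := g W' (1 / (n + 1 : ℝ))
  have hγ : Measurable fun y : X => γ • y := (continuous_const_smul γ).measurable
  have hcont : Continuous fun y : X => f (γ • y) :=
    f.continuous.comp (continuous_const_smul γ)
  let A : Set X := {y | γ • y ∉ W}
  have hA : MeasurableSet A := (hWo.preimage (continuous_const_smul γ)).measurableSet.compl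
  have hAW : A ⊆ {y | γ • y ∉ W'} := fun y hy h' => hy (hsub h')
  have hAle : (μ : Measure X).real A ≤ 1 / (n + 1 : ℝ) := (measureReal_mono hAW).trans hgn
  have hint : Integrable (fun y => f (γ • y)) (μ : Measure X) :=
    (Integrable.of_bound hcont.aestronglyMeasurable ‖f‖
      (Eventually.of_forall fun y => f.norm_coe_le_norm _))
  rw [ProbabilityMeasure.toMeasure_map, integral_map hγ.aemeasurable
    f.continuous.aestronglyMeasurable, Real.dist_eq]
  have hsubint : ∫ y, f (γ • y) ∂(μ : Measure X) - f x =
      ∫ y, (f (γ • y) - f x) ∂(μ : Measure X) := by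
    rw [integral_sub hint (integrable_const _)]
    simp
  have hbound : ∀ y, ‖f (γ • y) - f x‖ ≤ ε / 2 + A.indicator (fun _ => 2 * ‖f‖) y := by
    intro y
    by_cases hy : y ∈ A
    · rw [Set.indicator_of_mem hy]
      have := norm_sub_le (f (γ • y)) (f x)
      have h1 := f.norm_coe_le_norm (γ • y)
      have h2 := f.norm_coe_le_norm x
      linarith
    · rw [Set.indicator_of_notMem hy, add_zero, ← dist_eq_norm]
      exact (not_not.1 hy : dist (f (γ • y)) (f x) < ε / 2).le
  have hind : Integrable (A.indicator fun _ => 2 * ‖f‖) (μ : Measure X) :=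
    (integrable_const _).indicator hA
  rw [hsubint, ← Real.norm_eq_abs]
  calc ‖∫ y, (f (γ • y) - f x) ∂(μ : Measure X)‖
      ≤ ∫ y, (ε / 2 + A.indicator (fun _ => 2 * ‖f‖) y) ∂(μ : Measure X) :=
        norm_integral_le_of_norm_le ((integrable_const _).add hind)
          (Eventually.of_forall hbound)
    _ = ε / 2 + (μ : Measure X).real A * (2 * ‖f‖) := by
        rw [integral_add (integrable_const _) hind, integral_indicator_const _ hA]
        simp
    _ < ε := by
        have : (μ : Measure X).real A * (2 * ‖f‖) ≤ 2 * ‖f‖ * (1 / (n + 1 : ℝ)) := by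
          rw [mul_comm]
          gcongr
        linarith

/-! ### Dynamical consequences of the element `d` -/

namespace StoneSpace

variable {B G : Type*} [BooleanAlgebra B] [Group G] [MulAction G B]
  [CovariantClass G B (· • ·) (· ≤ ·)]

/-- If `{x}` were open, a translate of `d` would define a subset of `{x}`, so every translate would
define a set with at most one point. Yet two distinct points share a translate. -/
theorem not_isOpen_singleton [Nontrivial (StoneSpace B)] {d : B}
    (hsmall : ∀ a : B, a ≠ ⊥ → ∃ g : G, g • d ≤ a)
    (hprox : ∀ x z : StoneSpace B, ∃ g : G, g • d ∈ x.1 ∧ g • d ∈ z.1) (x : StoneSpace B) :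
    ¬ IsOpen {x} := by
  intro hx
  obtain ⟨a, hax, ha⟩ := exists_basicSet_subset (hx.mem_nhds rfl)
  obtain ⟨h, hh⟩ := hsmall a (ne_bot_of_mem hax)
  have key : ∀ (g : G) (y : StoneSpace B), g • d ∈ y.1 → y = (g * h⁻¹) • x := by
    intro g y hy
    have h1 : h • d ∈ ((h * g⁻¹) • y).1 := by
      rwa [mul_smul, smul_mem_smul_iff, ← smul_mem_smul_iff g, smul_inv_smul]
    have h2 : (h * g⁻¹) • y = x := ha (mem_of_le (x := (h * g⁻¹) • y) hh h1)
    rw [← h2, ← mul_smul]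
    simp
  obtain ⟨y, z, hyz⟩ := exists_pair_ne (StoneSpace B)
  obtain ⟨g, hy, hz⟩ := hprox y z
  exact hyz ((key g y hy).trans (key g z hz).symm)

theorem exists_mem_nhds_isCompressible
    (hcover : ∀ a : B, a ≠ ⊥ → ∃ F : Finset G, ∀ b, (∀ g ∈ F, Disjoint b (g • a)) → b = ⊥)
    {d : B} (hd : d ≠ ⊥) (hsmall : ∀ a : B, a ≠ ⊥ → ∃ g : G, g • d ≤ a) (x : StoneSpace B) :
    ∃ V ∈ 𝓝 x, IsCompressible G V := by
  obtain ⟨g, hg⟩ := exists_smul_mem hcover hd x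
  refine ⟨basicSet (g • d), (isOpen_basicSet _).mem_nhds hg,
    isCompressible_of_forall_nhds (isClosed_basicSet _) ⟨x, hg⟩ (x := x) fun W hW => ?_⟩
  obtain ⟨a, hax, ha⟩ := exists_basicSet_subset hW
  obtain ⟨h, hh⟩ := hsmall a (ne_bot_of_mem hax)
  refine ⟨h * g⁻¹, ?_⟩
  rw [smul_basicSet, mul_smul, inv_smul_smul]
  exact (basicSet_mono hh).trans ha

/-- The supremum `c` of the measures of translates of `d` is `1`; a translate of nearly full measure
can then be moved into any neighbourhood of `x`. -/
theorem isStronglyProximal {d : B}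
    (hsmall : ∀ a : B, a ≠ ⊥ → ∃ g : G, g • d ≤ a)
    (hprox : ∀ x z : StoneSpace B, ∃ g : G, g • d ∈ x.1 ∧ g • d ∈ z.1) :
    IsStronglyProximal G (StoneSpace B) := by
  classical
  intro μ
  have : Nonempty (StoneSpace B) := μ.nonempty
  obtain ⟨x⟩ := this
  have hmeas : ∀ a : B, MeasurableSet (basicSet a) := fun a => (isOpen_basicSet a).measurableSet
  have hbdd : BddAbove (Set.range fun g : G => (μ : Measure (StoneSpace B)).real
      (basicSet (g • d))) := ⟨1, by rintro _ ⟨g, rfl⟩; exact measureReal_le_one⟩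
  set c : ℝ := ⨆ g : G, (μ : Measure (StoneSpace B)).real (basicSet (g • d)) with hc
  have hle : ∀ g : G, (μ : Measure (StoneSpace B)).real (basicSet (g • d)) ≤ c :=
    fun g => le_ciSup hbdd g
  have hc1 : 1 ≤ c := by
    -- Finitely many translates of `d`, all containing `x`, cover the space. Their meet is nonzero,
    -- so it lies above a translate of `d`.
    obtain ⟨T, hT, hTtop⟩ := exists_finset_sup_eq_top
      (s := {b : B | b ∈ x.1 ∧ ∃ g : G, b = g • d}) fun z => by
        obtain ⟨g, hgx, hgz⟩ := hprox x z
        exact ⟨g • d, ⟨hgx, g, rfl⟩, hgz⟩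
    have hTx : T.inf id ∈ x.1 := finset_inf_mem_iff.2 fun b hb => (hT hb).1
    obtain ⟨g, hg⟩ := hsmall _ (ne_bot_of_mem hTx)
    refine le_of_forall_pos_le_add fun ε hε => ?_
    have hδ : 0 < ε / (T.card + 1) := by positivity
    obtain ⟨h, hh⟩ := exists_lt_of_lt_ciSup (sub_lt_self c hδ)
    -- Moving by `e` puts the nearly optimal `h • d` below the meet `b₀` of the moved cover. Each
    -- member has measure at most `c`, so it exceeds `b₀` by at most `ε / (T.card + 1)`; summing
    -- over the cover gives `1 ≤ c + ε`.
    let e : G := h * g⁻¹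
    let b₀ : B := e • T.inf id
    have hb₀ : h • d ≤ b₀ := by
      have := smul_le_smul_of_le e hg
      rwa [← mul_smul, inv_mul_cancel_right] at this
    have hb₀c : c - ε / (T.card + 1) < (μ : Measure (StoneSpace B)).real (basicSet b₀) :=
      hh.trans_le (measureReal_mono (basicSet_mono hb₀))
    have hdiff : ∀ t ∈ T, (μ : Measure (StoneSpace B)).real (basicSet (e • t) \ basicSet b₀) ≤
        ε / (T.card + 1) := by
      intro t ht
      obtain ⟨k, hk⟩ := (hT ht).2
      have hsub : basicSet b₀ ⊆ basicSet (e • t) :=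
        basicSet_mono (smul_le_smul_of_le e (Finset.inf_le (f := id) ht))
      rw [measureReal_sdiff hsub (hmeas _)]
      have := hle (e * k)
      rw [mul_smul, ← hk] at this
      linarith
    have hcov : (Set.univ : Set (StoneSpace B)) ⊆
        basicSet b₀ ∪ ⋃ t ∈ T, (basicSet (e • t) \ basicSet b₀) := by
      intro y _
      by_cases hy : y ∈ basicSet b₀
      · exact Or.inl hy
      · have : T.sup id ∈ (e⁻¹ • y).1 := by rw [hTtop]; exact top_mem _
        obtain ⟨t, ht, hty⟩ := finset_sup_mem_iff.1 this
        exact Or.inr (Set.mem_iUnion₂.2 ⟨t, ht, (smul_mem_iff e).2 hty, hy⟩)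
    have hb₀le : (μ : Measure (StoneSpace B)).real (basicSet b₀) ≤ c := by
      have : T.sup id ∈ x.1 := by rw [hTtop]; exact top_mem _
      obtain ⟨t, ht, -⟩ := finset_sup_mem_iff.1 this
      obtain ⟨k, hk⟩ := (hT ht).2
      refine le_trans (measureReal_mono
        (basicSet_mono (smul_le_smul_of_le e (Finset.inf_le (f := id) ht)))) ?_
      have := hle (e * k)
      rwa [mul_smul, ← hk] at this
    calc (1 : ℝ) = (μ : Measure (StoneSpace B)).real Set.univ := probReal_univ.symm
      _ ≤ (μ : Measure (StoneSpace B)).real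
          (basicSet b₀ ∪ ⋃ t ∈ T, (basicSet (e • t) \ basicSet b₀)) := measureReal_mono hcov
      _ ≤ c + ∑ t ∈ T, ε / (T.card + 1) := by
          refine (measureReal_union_le _ _).trans (add_le_add hb₀le ?_)
          exact (measureReal_biUnion_finset_le _ _).trans (Finset.sum_le_sum hdiff)
      _ ≤ c + ε := by
          rw [Finset.sum_const, nsmul_eq_mul, mul_div_assoc', add_le_add_iff_left,
            div_le_iff₀ (by positivity)]
          nlinarith
  refine ⟨x, diracProba_mem_closure_of_forall_nhds μ x fun W hW ε hε => ?_⟩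
  obtain ⟨a, hax, ha⟩ := exists_basicSet_subset hW
  obtain ⟨g, hg⟩ := hsmall a (ne_bot_of_mem hax)
  obtain ⟨h, hh⟩ := exists_lt_of_lt_ciSup (sub_lt_self c hε)
  refine ⟨g * h⁻¹, ?_⟩
  have hsub : {y : StoneSpace B | (g * h⁻¹) • y ∉ W} ⊆ (basicSet (h • d))ᶜ := by
    intro y hy hyd
    refine hy (ha (mem_of_le (x := (g * h⁻¹) • y) hg ?_))
    rwa [mul_smul, smul_mem_smul_iff, ← smul_mem_iff]
  refine (measureReal_mono hsub).trans ?_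
  rw [probReal_compl_eq_one_sub (hmeas _)]
  linarith

/-- The dynamics of a faithful micro-supported action on a Boolean algebra by a group of class
`𝒮`. -/
theorem dynamics [Nontrivial (StoneSpace B)] [TopologicalSpace G] [IsClassS G]
    (hstab : ∀ a : B, IsOpen (MulAction.stabilizer G a : Set G))
    (hfaith : ∀ g : G, (∀ a : B, g • a = a) → g = 1)
    (hrist : ∀ a : B, a ≠ ⊥ → ∀ V : Subgroup G, IsOpen (V : Set G) →
      ∃ k ∈ V, k ≠ 1 ∧ ∀ b : B, Disjoint b a → k • b = b)
    (hcover : ∀ a : B, a ≠ ⊥ → ∃ F : Finset G, ∀ b, (∀ g ∈ F, Disjoint b (g • a)) → b = ⊥) :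
    (∀ x : StoneSpace B, ¬ IsOpen {x}) ∧
    (ContinuousSMul G (StoneSpace B) ∧ FaithfulSMul G (StoneSpace B)) ∧
    MulAction.IsMinimal G (StoneSpace B) ∧
    IsStronglyProximal G (StoneSpace B) ∧
    (∀ x : StoneSpace B, ∃ V ∈ 𝓝 x, IsCompressible G V) := by
  have hB : Nontrivial B := by
    obtain ⟨x⟩ := (inferInstance : Nonempty (StoneSpace B))
    exact ⟨⊤, ⊥, ne_bot_of_mem (top_mem x)⟩
  obtain ⟨D, hD, hDa⟩ := exists_finset_forall_exists_le_smul hstab hfaith hrist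
  obtain ⟨d, hd, hsmall⟩ := exists_forall_exists_smul_le hcover D hD fun a ha => by
    obtain ⟨g, e, he, hle⟩ := hDa a ha
    exact ⟨g⁻¹, e, he, by rwa [smul_le_iff_le_inv_smul, inv_inv]⟩
  have hprox := exists_smul_mem_and_smul_mem hstab hcover hd (by
    obtain ⟨k, -, hk⟩ := hrist d hd ⊤ isOpen_univ
    exact ⟨k, hk⟩)
  exact ⟨not_isOpen_singleton hsmall hprox, ⟨continuousSMul hstab, faithfulSMul hfaith⟩,
    isMinimal hcover, isStronglyProximal hsmall hprox,
    exists_mem_nhds_isCompressible hcover hd hsmall⟩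

end StoneSpace

/-! ### The action on the Stone space of the centraliser lattice -/

namespace CentraliserLattice

open StructureLattice

variable {G : Type*} [Group G] [TopologicalSpace G] [IsClassS G]

attribute [local instance] booleanAlgebra

theorem coe_bot : ((⊥ : CentraliserLattice G) : StructureLattice G) = ⊥ :=
  le_bot_iff.1 (bot_le : (⊥ : CentraliserLattice G) ≤ ⟨⊥, bot_mem_centraliserLattice⟩)

theorem coe_top : ((⊤ : CentraliserLattice G) : StructureLattice G) = ⊤ :=
  top_le_iff.1 (le_top : (⟨⊤, top_mem_centraliserLattice⟩ : CentraliserLattice G) ≤ ⊤)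

theorem coe_ne_bot {a : CentraliserLattice G} (ha : a ≠ ⊥) : (a : StructureLattice G) ≠ ⊥ :=
  fun h => ha (Subtype.ext (h.trans coe_bot.symm))

/-- Disjointness in the centraliser lattice is disjointness in the structure lattice. -/
theorem disjoint_coe_iff {a b : CentraliserLattice G} :
    Disjoint (a : StructureLattice G) b ↔ Disjoint a b := by
  constructor
  · intro h x hxa hxb
    have : (x : StructureLattice G) ≤ ⊥ := h hxa hxb
    rw [← coe_bot] at this
    exact this
  · intro h
    -- The Boolean complement of `b` is its pseudo-complement in the whole structure lattice, so `a
    -- ≤ bᶜ` gives disjointness there.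
    obtain ⟨γ, hγ⟩ := exists_isPerp (b : StructureLattice G)
    have h1 : (⟨γ, ⟨_, hγ⟩⟩ : CentraliserLattice G) = bᶜ := by
      refine le_antisymm (le_compl_iff_disjoint_right.2 fun x hx hxb => ?_) ?_
      · have : (x : StructureLattice G) ≤ ⊥ := (hγ.le_iff_disjoint.1 le_rfl) hx hxb
        rw [← coe_bot] at this
        exact this
      · exact (exists_isPerp (b : StructureLattice G)).choose_spec.le_iff_disjoint.1 le_rfl |>
          hγ.le_iff_disjoint.2
    have h2 : a ≤ ⟨γ, ⟨_, hγ⟩⟩ := h1 ▸ le_compl_iff_disjoint_right.2 h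
    exact hγ.le_iff_disjoint.1 h2

theorem isOpen_stabilizer_coe (a : CentraliserLattice G) :
    IsOpen (MulAction.stabilizer G a : Set G) := by
  have : MulAction.stabilizer G a = MulAction.stabilizer G (a : StructureLattice G) :=
    Subgroup.ext fun g => Subtype.ext_iff
  rw [this]
  exact StructureLattice.isOpen_stabilizer _

theorem nontrivial_stoneOmega (h : CentraliserLattice G ≠ {⊥, ⊤}) :
    Nontrivial (StoneOmega G) := by
  obtain ⟨α, hα, hα0, hα1⟩ := exists_mem_centraliserLattice_ne h
  let a : CentraliserLattice G := ⟨α, hα⟩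
  have ha0 : a ≠ ⊥ := fun h => hα0 ((congrArg Subtype.val h).trans coe_bot)
  have ha1 : aᶜ ≠ ⊥ := fun h =>
    hα1 ((congrArg Subtype.val (compl_eq_bot.1 h)).trans coe_top)
  obtain ⟨x, hx⟩ := StoneSpace.exists_mem_of_ne_bot ha0
  obtain ⟨y, hy⟩ := StoneSpace.exists_mem_of_ne_bot ha1
  refine ⟨x, y, ?_⟩
  rintro rfl
  exact StoneSpace.compl_mem_iff.1 hy hx

end CentraliserLattice

theorem mainTheorem5 (G : Type*) [Group G] [TopologicalSpace G] [IsClassS G]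
    (h : CentraliserLattice G ≠ {⊥, ⊤}) :
    (∀ ω : StoneOmega G, ¬ IsOpen {ω}) ∧
    (ContinuousSMul G (StoneOmega G) ∧ FaithfulSMul G (StoneOmega G)) ∧
    MulAction.IsMinimal G (StoneOmega G) ∧
    IsStronglyProximal G (StoneOmega G) ∧
    (∀ ω : StoneOmega G, ∃ V ∈ nhds ω, IsCompressible G V) := by
  let _ := CentraliserLattice.booleanAlgebra G
  have := CentraliserLattice.nontrivial_stoneOmega h
  refine StoneSpace.dynamics (B := CentraliserLattice G)
    CentraliserLattice.isOpen_stabilizer_coe ?_ ?_ ?_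
  · intro g hg
    exact StructureLattice.eq_one_of_forall_smul_eq h fun α hα => congrArg Subtype.val (hg ⟨α, hα⟩)
  · intro a ha V hV
    obtain ⟨k, hkV, hk1, hk⟩ :=
      StructureLattice.exists_mem_ne_one_forall_smul_eq (CentraliserLattice.coe_ne_bot ha) hV
    exact ⟨k, hkV, hk1, fun b hb => Subtype.ext (hk b (CentraliserLattice.disjoint_coe_iff.2 hb))⟩
  · intro a ha
    obtain ⟨F, hF⟩ :=
      StructureLattice.exists_finset_forall_disjoint (CentraliserLattice.coe_ne_bot ha)
    refine ⟨F, fun b hb => Subtype.ext ((hF b fun g hg => ?_).trans CentraliserLattice.coe_bot.symm)⟩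
    exact CentraliserLattice.disjoint_coe_iff.2 (hb g hg)
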